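/- Let $\mathbb T=\mathbb R/\mathbb Z$, let $g$ be a smooth Riemannian metric on $\mathbb T^2=\mathbb R^2/\mathbb Z^2$ and $\sigma$ a smooth 2-form on $\mathbb T^2$ that takes both positive and negative values. Let $\mathcal M=H^1(\mathbb T,\mathbb T^2)\times(0,\infty)$ be the Hilbert manifold of $H^1$-loops $\gamma=(x,T)$ with arbitrary period. Write $\gamma^n=(x(n\,\cdot),nT)$ for the $n$-th iterate, $n\ge 1$, and $\mathbb T\cdot\gamma=\{(x(\psi+\cdot),T):\psi\in\mathbb T\}$. For $k>0$ let $$\eta_k(x,T)=d\mathbb A_k(x,T)+\int_0^1\sigma_{x(s)}(\,\cdot\,,x'(s))\,ds,\qquad \mathbb A_k(x,T)=\frac1{2T}\int_0^1|x'(s)|^2ds+kT,$$ which is a closed 1-form on $\mathcal M$, and let $\tau$ be the closed 1-form $\tau_{(x,T)}=\int_0^1\bar\sigma(\,\cdot\,,x'(s))\,ds$ with $\bar\sigma=dq^1\wedge dq^2$. Integrals of closed 1-forms along continuous paths are defined by means of local primitives. Let $k^*>0$ and let $\alpha=(x_\alpha,T_\alpha)\in\mathcal M$ be a non-contractible loop.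 Choose a point $q_0\in\mathbb T^2$ not on $\alpha$ and a smooth 1-form $\theta$ on $\mathbb T^2\setminus\{q_0\}$ with $d\theta=\sigma$. On the open set $\mathcal V\subset\mathcal M$ of the loops avoiding $q_0$ let $$\mathbb S_k(x,T)=T\int_0^1\Big(\tfrac1{2T^2}|x'(s)|^2+\tfrac1T\theta_{x(s)}(x'(s))+k\Big)ds ,$$ a primitive of $\eta_k|_{\mathcal V}$. Assume that $\alpha$ is a strict local minimizer of the action with energy $k^*$: there is an open neighbourhood of $\mathbb T\cdot\alpha$ in $\mathcal V$ on which $\mathbb S_{k^*}\ge\mathbb S_{k^*}(\alpha)$, with strict inequality off $\mathbb T\cdot\alpha$. Let $\mathcal U$ be a bounded open neighbourhood of $\mathbb T\cdot\alpha$ with $\overline{\mathcal U}\subset\mathcal V$ and $\inf_{\partial\mathcal U}\mathbb S_{k^*}>\mathbb S_{k^*}(\alpha)$, and let $M_k$ be the closure of the set of local minimizers of $\mathbb S_k$ in $\mathcal U$. Let $I\subset(0,\infty)$ be an open interval containing $k^*$ such that 1. for every $k\in I$ the set $M_k$ is non-empty and compact; 2. for all $k_-<k_+$ in $I$ and all $\beta\in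 M_{k_+}$ there is a continuous path $w:[0,1]\to\mathcal U$ with $w(0)\in M_{k_-}$, $w(1)=\beta$ and $\mathbb S_{k_-}\circ w\le\mathbb S_{k_-}(\beta)$. For $n\ge1$ let $\mathcal N^n$ be the connected component of $\mathcal M$ containing $\alpha^n$, let $M_k^n=\{\beta^n:\beta\in M_k\}$, and for $k\in I$ let $$\mathcal P_n(k)=\Big\{u:[0,1]\to\mathcal N^n\text{ continuous}\ \Big|\ u(0)=u(1)\in M_k^n,\ \int_0^1u^*\tau\ne0\Big\},$$ $$\mathbb S_k(u,s)=\mathbb S_k(u(0))+\int_0^su^*\eta_k,\qquad c_n(k)=\inf_{u\in\mathcal P_n(k)}\ \max_{s\in[0,1]}\mathbb S_k(u,s),$$ the infimum being taken in the extended real numbers. Then for every integer $n\ge1$ and all $k_-,k_+\in I$ with $k_-<k_+$ one has $c_n(k_-)\le c_n(k_+)$. -/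

import Mathlib

open MeasureTheory Set Filter Topology
open scoped ContDiff

noncomputable section

namespace MagneticTorus

/-! ### The torus, Riemannian metrics and differential forms on it -/

/-- The Euclidean plane, which is also the model of every tangent space of the torus. -/
abbrev Plane : Type := EuclideanSpace ℝ (Fin 2)

/-- The two-torus `ℝ² / ℤ²`. -/
abbrev Torus : Type := Fin 2 → UnitAddCircle

/-- The universal covering `ℝ² → ℝ² / ℤ²`. -/
def proj (p : Plane) : Torus := fun i => ((p i : ℝ) : UnitAddCircle)

/-- A smooth Riemannian metric on the torus, written in the Cartesian frame. -/
structure TorusMetric where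
  val : Torus → Plane →L[ℝ] Plane →L[ℝ] ℝ
  smooth : ContDiff ℝ ∞ (fun p : Plane => val (proj p))
  symm : ∀ q u v, val q u v = val q v u
  pos : ∀ q v, v ≠ 0 → 0 < val q v v

/-- The standard area form `dq¹ ∧ dq²` on `ℝ²`. -/
def area (u v : Plane) : ℝ := u 0 * v 1 - u 1 * v 0

/-- A smooth 2-form on the torus, `coeff · dq¹ ∧ dq²`. -/
structure TwoForm where
  coeff : Torus → ℝ
  smooth : ContDiff ℝ ∞ (fun p : Plane => coeff (proj p))

/-- The value `σ_q(u, v)`. -/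
def TwoForm.eval (σ : TwoForm) (q : Torus) (u v : Plane) : ℝ := σ.coeff q * area u v

/-- The form takes both signs. -/
def TwoForm.Oscillating (σ : TwoForm) : Prop :=
  (∃ q, σ.coeff q < 0) ∧ ∃ q, 0 < σ.coeff q

/-- The form `dq¹ ∧ dq²` on the torus. -/
def stdArea : TwoForm where
  coeff := fun _ => 1
  smooth := contDiff_const

/-- `θ` is a smooth 1-form on the torus minus the point `q₀` with `dθ = σ` there
(the value of `θ` at `q₀` is irrelevant). -/
structure IsPrimitiveAway (σ : TwoForm) (q₀ : Torus) (θ : Torus → Plane →L[ℝ] ℝ) : Prop where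
  smooth : ContDiffOn ℝ ∞ (fun p : Plane => θ (proj p)) {p | proj p ≠ q₀}
  d_eq : ∀ p : Plane, proj p ≠ q₀ → ∀ u v : Plane,
    fderiv ℝ (fun p : Plane => θ (proj p)) p u v - fderiv ℝ (fun p : Plane => θ (proj p)) p v u
      = σ.eval (proj p) u v

/-! ### Loops of class `H¹` -/

/-- Square-integrable vector fields `𝕋 → ℝ²`. -/
abbrev L2 : Type := Lp Plane 2 (volume : Measure UnitAddCircle)

lemma proj_add (p q : Plane) : proj (p + q) = proj p + proj q := by
  ext i; simp [proj]

lemma proj_neg (p : Plane) : proj (-p) = - proj p := by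
  ext i; simp [proj]

lemma proj_zero : proj 0 = 0 := by
  ext i; simp [proj]

lemma continuous_proj : Continuous proj :=
  continuous_pi fun i =>
    (AddCircle.continuous_mk' 1).comp (by fun_prop : Continuous fun p : Plane => p i)

lemma quasi_mk : Measure.QuasiMeasurePreserving (fun r : ℝ => (r : UnitAddCircle)) := by
  refine ⟨AddCircle.measurable_mk', ?_⟩
  refine Measure.AbsolutelyContinuous.mk fun s hs h0 => ?_
  rw [Measure.map_apply AddCircle.measurable_mk' hs]
  have hcov : ((fun r : ℝ => (r : UnitAddCircle)) ⁻¹' s)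
      ⊆ ⋃ n : ℤ, ((fun r : ℝ => (r : UnitAddCircle)) ⁻¹' s) ∩ Ioc (n : ℝ) (n + 1) := by
    intro r hr
    refine mem_iUnion.2 ⟨⌈r⌉ - 1, hr, ?_, ?_⟩
    · push_cast; linarith [Int.ceil_lt_add_one r]
    · push_cast; linarith [Int.le_ceil r]
  refine measure_mono_null hcov (measure_iUnion_null fun n => ?_)
  have h := (AddCircle.add_projection_respects_measure 1 (n : ℝ) hs)
  rw [h0] at h
  exact h.symm

lemma intervalIntegrable_vel (v : L2) (a b : ℝ) :
    IntervalIntegrable (fun r : ℝ => v (r : UnitAddCircle)) volume a b := by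
  have hint : Integrable (v : UnitAddCircle → Plane) volume :=
    (Lp.memLp v).integrable (by norm_num)
  have hper : Function.Periodic (fun r : ℝ => v (r : UnitAddCircle)) 1 := by
    intro r; simp
  refine hper.intervalIntegrable₀ one_ne_zero ?_ a b
  rw [intervalIntegrable_iff_integrableOn_Ioc_of_le zero_le_one]
  have h := (UnitAddCircle.measurePreserving_mk 0).integrable_comp_of_integrable hint
  simpa [IntegrableOn, Function.comp_def] using! h

/-- The displacement `∫₀ᵗ v` in `ℝ²`. -/
def displacement (v : L2) (t : ℝ) : Plane := ∫ r in (0 : ℝ)..t, v (r : UnitAddCircle)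

lemma integral_congr_L2 {f g : UnitAddCircle → Plane} (h : f =ᵐ[volume] g) (t : ℝ) :
    ∫ r in (0 : ℝ)..t, f (r : UnitAddCircle) = ∫ r in (0 : ℝ)..t, g (r : UnitAddCircle) := by
  refine intervalIntegral.integral_congr_ae ?_
  filter_upwards [quasi_mk.ae h] with r hr _ using hr

lemma displacement_add (v w : L2) (t : ℝ) :
    displacement (v + w) t = displacement v t + displacement w t := by
  unfold displacement
  rw [integral_congr_L2 (Lp.coeFn_add v w)]
  exact intervalIntegral.integral_add (intervalIntegrable_vel v 0 t) (intervalIntegrable_vel w 0 t)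

lemma displacement_smul (c : ℝ) (v : L2) (t : ℝ) :
    displacement (c • v) t = c • displacement v t := by
  unfold displacement
  rw [integral_congr_L2 (Lp.coeFn_smul c v)]
  exact intervalIntegral.integral_smul c _

lemma displacement_zero (t : ℝ) : displacement 0 t = 0 := by
  simpa using displacement_smul 0 0 t

lemma displacement_neg (v : L2) (t : ℝ) : displacement (-v) t = - displacement v t := by
  simpa using displacement_smul (-1) v t

/-- The space `H¹(𝕋, 𝕋²)`: continuous loops `x` in the torus together with their (uniquely
determined) weak derivative `x' ∈ L²`, so that `x(t) = x(0) + ∫₀ᵗ x'` for all `t`.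
It is a group under pointwise addition, and its topology, inherited from `C⁰ × L²`,
is the `H¹` topology. -/
def h1Loops : AddSubgroup (C(UnitAddCircle, Torus) × L2) where
  carrier := {x | ∀ t : ℝ, x.1 (t : UnitAddCircle) = x.1 0 + proj (displacement x.2 t)}
  add_mem' := by
    intro x y hx hy t
    simp only [Prod.fst_add, Prod.snd_add, ContinuousMap.add_apply, displacement_add, proj_add,
      hx t, hy t]
    abel
  zero_mem' := by intro t; simp [displacement_zero, proj_zero]
  neg_mem' := by
    intro x hx t
    simp only [Prod.fst_neg, Prod.snd_neg, ContinuousMap.neg_apply, displacement_neg, proj_neg,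
      hx t]
    abel

/-- The space `H¹(𝕋, ℝ²)` of `H¹` vector fields along loops: continuous maps `ξ` with weak
derivative `ξ' ∈ L²`. The norm inherited from `C⁰ × L²` is equivalent to the `H¹` norm. -/
def h1Fields : Submodule ℝ (C(UnitAddCircle, Plane) × L2) where
  carrier := {ξ | ∀ t : ℝ, ξ.1 (t : UnitAddCircle) = ξ.1 0 + displacement ξ.2 t}
  add_mem' := by
    intro x y hx hy t
    simp only [Prod.fst_add, Prod.snd_add, ContinuousMap.add_apply, displacement_add, hx t, hy t]
    abel
  zero_mem' := by intro t; simp [displacement_zero]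
  smul_mem' := by
    intro c x hx t
    simp only [Prod.smul_fst, Prod.smul_snd, ContinuousMap.smul_apply, displacement_smul, hx t,
      smul_add]

abbrev H1Loop : Type := h1Loops
abbrev H1Field : Type := h1Fields

/-- The space `𝓜 = H¹(𝕋, 𝕋²) × (0, ∞)` of `H¹` loops with arbitrary period. -/
abbrev Loops : Type := H1Loop × Ioi (0 : ℝ)

/-- The loop `x : 𝕋 → 𝕋²` of `γ = (x, T)`. -/
def Loops.loop (γ : Loops) : C(UnitAddCircle, Torus) := γ.1.1.1

/-- The derivative `x'` of the loop of `γ = (x, T)`. -/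
def Loops.vel (γ : Loops) : L2 := γ.1.1.2

/-- The period `T` of `γ = (x, T)`. -/
def Loops.period (γ : Loops) : ℝ := γ.2.1

/-- The tangent space `H¹(𝕋, ℝ²) × ℝ` of `𝓜`; the tangent bundle of the torus is trivial. -/
abbrev Tangent : Type := H1Field × ℝ

/-- The projection of a vector field along loops to a loop in the torus. -/
def projField (ξ : H1Field) : H1Loop :=
  ⟨(ContinuousMap.comp ⟨proj, continuous_proj⟩ ξ.1.1, ξ.1.2), by
    intro t
    change proj (ξ.1.1 (t : UnitAddCircle)) = proj (ξ.1.1 0) + proj (displacement ξ.1.2 t)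
    rw [ξ.2 t, proj_add]⟩

/-- The chart `(ξ, S) ↦ (x + ξ, T + S)` of `𝓜` centred at `γ = (x, T)`. Only its germ at `0`
is used, so the values for `T + S ≤ 0` are irrelevant. -/
def chart (γ : Loops) (h : Tangent) : Loops :=
  (γ.1 + projField h.1, if hS : 0 < γ.2.1 + h.2 then ⟨γ.2.1 + h.2, hS⟩ else γ.2)

lemma measurePreserving_nsmul (n : ℕ+) :
    MeasurePreserving (fun s : UnitAddCircle => (n : ℕ) • s) volume volume := by
  simpa using MeasureTheory.Measure.measurePreserving_zsmul (volume : Measure UnitAddCircle)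
    (n := ((n : ℕ) : ℤ)) (by exact_mod_cast n.ne_zero)

lemma displacement_iterate (n : ℕ+) (v : L2) (t : ℝ) :
    displacement (((n : ℕ) : ℝ) • Lp.compMeasurePreserving _ (measurePreserving_nsmul n) v) t
      = displacement v (n * t) := by
  rw [displacement_smul]
  unfold displacement
  rw [integral_congr_L2 (Lp.coeFn_compMeasurePreserving v (measurePreserving_nsmul n))]
  have h := intervalIntegral.smul_integral_comp_mul_left (a := 0) (b := t)
    (fun r : ℝ => v (r : UnitAddCircle)) ((n : ℕ) : ℝ)
  rw [mul_zero] at h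
  rw [← h]
  congr 1
  refine intervalIntegral.integral_congr fun r _ => ?_
  simp [Function.comp]

/-- The iterate `γⁿ = (xⁿ, n T)`, where `xⁿ(s) = x(n s)`. -/
def iterate (n : ℕ+) (γ : Loops) : Loops :=
  (⟨(⟨fun s => γ.loop ((n : ℕ) • s), by fun_prop⟩,
      ((n : ℕ) : ℝ) • Lp.compMeasurePreserving _ (measurePreserving_nsmul n) γ.vel), by
    intro t
    change γ.loop ((n : ℕ) • (t : UnitAddCircle)) = γ.loop ((n : ℕ) • 0) + proj (displacement _ t)
    rw [displacement_iterate, smul_zero]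
    have h := γ.1.2 (n * t)
    have h2 : (((n : ℕ) * t : ℝ) : UnitAddCircle) = (n : ℕ) • (t : UnitAddCircle) := by simp
    rw [h2] at h
    exact h⟩,
   ⟨(n : ℕ) * γ.2.1, mem_Ioi.2 (mul_pos (by exact_mod_cast n.pos) (mem_Ioi.1 γ.2.2))⟩)

/-- The orbit `𝕋 · γ` of `γ = (x, T)` under `ψ · (x, T) = (x(ψ + ·), T)`. -/
def orbit (γ : Loops) : Set Loops :=
  {β | ∃ ψ : UnitAddCircle, (∀ s, β.loop s = γ.loop (ψ + s)) ∧ β.period = γ.period}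

/-- `γ` is a contractible loop. -/
def Contractible (γ : Loops) : Prop := γ.loop.Nullhomotopic

/-- Boundedness in `𝓜` (the torus is compact, so only derivatives and periods matter). -/
def BoundedLoops (U : Set Loops) : Prop := ∃ C : ℝ, ∀ γ ∈ U, ‖γ.vel‖ ≤ C ∧ γ.period ≤ C

/-! ### The action 1-form and its primitives -/

/-- The kinetic energy `e(x) = ½ ∫ |x'|²`. -/
def kinetic (g : TorusMetric) (γ : Loops) : ℝ :=
  (1 / 2) * ∫ s : UnitAddCircle, g.val (γ.loop s) (γ.vel s) (γ.vel s)

/-- The functional `𝔸_k(x, T) = e(x) / T + k T`. -/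
def kineticAction (g : TorusMetric) (k : ℝ) (γ : Loops) : ℝ :=
  kinetic g γ / γ.period + k * γ.period

/-- A (not necessarily continuous) 1-form on `𝓜`. -/
abbrev OneForm : Type := Loops → Tangent → ℝ

/-- The transgression `(ξ, S) ↦ ∫ σ_x(ξ, x')` of a 2-form. -/
def transgression (σ : TwoForm) : OneForm := fun γ h =>
  ∫ s : UnitAddCircle, σ.eval (γ.loop s) (h.1.1.1 s) (γ.vel s)

/-- The action 1-form `η_k = d𝔸_k + ∫ σ_x(·, x')`. -/
def actionForm (g : TorusMetric) (σ : TwoForm) (k : ℝ) : OneForm := fun γ h =>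
  fderiv ℝ (fun h' => kineticAction g k (chart γ h')) 0 h + transgression σ γ h

/-- `f` is (Fréchet) differentiable on `W` with `df = η`. -/
def IsPrimitiveOn (η : OneForm) (f : Loops → ℝ) (W : Set Loops) : Prop :=
  ∀ γ ∈ W, ∃ L : Tangent →L[ℝ] ℝ,
    HasFDerivAt (fun h => f (chart γ h)) L 0 ∧ ∀ h, L h = η γ h

/-- `F(s) = ∫₀ˢ u^* η` for a closed 1-form `η` and a continuous path `u`: `F` starts at `0`, and
near every parameter its increments are those of a local primitive of `η` along `u`.
As `η` is closed, there is exactly one such `F`. -/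
def IsIntegralAlong (η : OneForm) (u : C(unitInterval, Loops)) (F : unitInterval → ℝ) : Prop :=
  F 0 = 0 ∧ ∀ s₀ : unitInterval, ∃ (W : Set Loops) (f : Loops → ℝ),
    IsOpen W ∧ u s₀ ∈ W ∧ IsPrimitiveOn η f W ∧
      ∀ᶠ s in 𝓝 s₀, F s - F s₀ = f (u s) - f (u s₀)

/-- The open set `𝓥` of loops which avoid the point `q₀`. -/
def avoiding (q₀ : Torus) : Set Loops := {γ | ∀ s, γ.loop s ≠ q₀}

/-- The free-period action functional `T ∫ (½ |x'/T|² + θ_x(x'/T) + k)`, which is used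
on the set of loops avoiding the point where `θ` is not defined. -/
def freeAction (g : TorusMetric) (θ : Torus → Plane →L[ℝ] ℝ) (k : ℝ) (γ : Loops) : ℝ :=
  γ.period * ∫ s : UnitAddCircle,
    ((1 / 2) * g.val (γ.loop s) (γ.period⁻¹ • γ.vel s) (γ.period⁻¹ • γ.vel s)
      + θ (γ.loop s) (γ.period⁻¹ • γ.vel s) + k)

/-- `α` is a strict local minimizer of the action with energy `k`; `θ` is a primitive of `σ`
away from a point `q₀` which does not lie on `α`. -/
def IsStrictLocalMinimizer (g : TorusMetric) (q₀ : Torus) (θ : Torus → Plane →L[ℝ] ℝ) (k : ℝ)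
    (α : Loops) : Prop :=
  ∃ U : Set Loops, IsOpen U ∧ orbit α ⊆ U ∧ U ⊆ avoiding q₀ ∧
    (∀ γ ∈ U, freeAction g θ k α ≤ freeAction g θ k γ) ∧
    ∀ γ ∈ U \ orbit α, freeAction g θ k α < freeAction g θ k γ

/-- `U` is a bounded open neighbourhood of `𝕋 · α`, contained with its boundary in the domain
of the action functional, and `inf_{∂U} 𝕊_k > 𝕊_k(α)`. -/
structure IsMinimizerNeighborhood (g : TorusMetric) (q₀ : Torus) (θ : Torus → Plane →L[ℝ] ℝ) (k : ℝ)
    (α : Loops) (U : Set Loops) : Prop where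
  isOpen : IsOpen U
  orbit_subset : orbit α ⊆ U
  closure_subset : closure U ⊆ avoiding q₀
  bounded : BoundedLoops U
  lt_boundary : ∃ c : ℝ, freeAction g θ k α < c ∧ ∀ γ ∈ frontier U, c ≤ freeAction g θ k γ

/-- `M_k`: the closure of the set of the local minimizers of `𝕊_k` in `U`. -/
def minimizers (g : TorusMetric) (θ : Torus → Plane →L[ℝ] ℝ) (U : Set Loops) (k : ℝ) : Set Loops :=
  closure {β | β ∈ U ∧ IsLocalMin (freeAction g θ k) β}

/-- The interval of energies on which the minimax values are defined: an open interval `I` of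
positive numbers around `kstar` such that `M_k` is non-empty and compact for `k ∈ I`, and
such that for `k₋ < k₊` in `I` every point `β` of `M_{k₊}` can be joined to `M_{k₋}` by a path
in `U` on which `𝕊_{k₋}` is at most `𝕊_{k₋}(β)`. -/
structure IsMinimaxInterval (g : TorusMetric) (θ : Torus → Plane →L[ℝ] ℝ) (U : Set Loops)
    (kstar : ℝ) (I : Set ℝ) : Prop where
  isOpen : IsOpen I
  ordConnected : I.OrdConnected
  mem : kstar ∈ I
  pos : I ⊆ Ioi 0
  nonempty : ∀ k ∈ I, (minimizers g θ U k).Nonempty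
  compact : ∀ k ∈ I, IsCompact (minimizers g θ U k)
  connect : ∀ km ∈ I, ∀ kp ∈ I, km < kp → ∀ β ∈ minimizers g θ U kp,
    ∃ w : C(unitInterval, Loops), (∀ s, w s ∈ U) ∧ w 0 ∈ minimizers g θ U km ∧ w 1 = β ∧
      ∀ s, freeAction g θ km (w s) ≤ freeAction g θ km β

/-! ### The minimax values -/

/-- `𝓟_n(k)`: the closed continuous paths in the component of `αⁿ`, based at an `n`-th iterate
of an element of `M_k`, over which the integral of the transgression of `dq¹ ∧ dq²`
does not vanish. -/
def minimaxClass (g : TorusMetric) (θ : Torus → Plane →L[ℝ] ℝ) (α : Loops) (U : Set Loops)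
    (n : ℕ+) (k : ℝ) : Set C(unitInterval, Loops) :=
  {u | (∀ s, u s ∈ connectedComponent (iterate n α)) ∧ u 0 = u 1 ∧
    u 0 ∈ iterate n '' minimizers g θ U k ∧
    ∃ G, IsIntegralAlong (transgression stdArea) u G ∧ G 1 ≠ 0}

/-- `𝕊_k(u, s) = 𝕊_k(u(0)) + ∫₀ˢ u^* η_k`, where `F` is the integral of `η_k` along `u`. -/
def actionAlong (g : TorusMetric) (θ : Torus → Plane →L[ℝ] ℝ) (k : ℝ) (u : C(unitInterval, Loops))
    (F : unitInterval → ℝ) (s : unitInterval) : ℝ :=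
  freeAction g θ k (u 0) + F s

/-- The minimax value `c_n(k) = inf_{u ∈ 𝓟_n(k)} max_s 𝕊_k(u, s)`, as an extended real number,
so that no convention about infima of reals enters. The inner infimum ranges over the one
integral `F` of `η_k` along `u`. -/
def minimaxValue (g : TorusMetric) (σ : TwoForm) (θ : Torus → Plane →L[ℝ] ℝ) (α : Loops)
    (U : Set Loops) (n : ℕ+) (k : ℝ) : EReal :=
  ⨅ u ∈ minimaxClass g θ α U n k, ⨅ F, ⨅ _ : IsIntegralAlong (actionForm g σ k) u F,
    ⨆ s : unitInterval, ((actionAlong g θ k u F s : ℝ) : EReal)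

end MagneticTorus

end

noncomputable section

namespace MagneticTorus

/-!
Let `u` be a loop in the minimax class for `k₊`, based at `βⁿ`, and let `w` be a path from `M_{k₋}`
to `β` along which `𝕊_{k₋}` stays below `𝕊_{k₋}(β)`. Conjugating `u` by the iterated path
`p = wⁿ` gives a loop `v = p · u · p⁻¹` based at an iterate of an element of `M_{k₋}`; the integral
of the closed form `τ` does not change. Along the two outer pieces of `v` the action with energy
`k₋` stays below its values at the two ends of the middle piece, because
`𝕊_{k₋}(γⁿ) = n 𝕊_{k₋}(γ)`. Along the middle piece it is the action with energy `k₊` minus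
`(k₊ - k₋) T`, where `T > 0` is the period. So the maximum over `v` is at most that over `u`.

The analytic input is that the 1-forms involved have local primitives near every loop they are
integrated over: `∫ θ_x(x')` together with `𝔸_k` for `η_k`, whose derivative is computed by
integrating by parts, and a quadratic function in every chart for `τ`.
-/

section Primitives

lemma absolutelyContinuousOnInterval_of_dist_le {X Y : Type*} [PseudoMetricSpace X]
    [PseudoMetricSpace Y] {f : ℝ → X} {g : ℝ → Y} {a b K : ℝ}
    (hg : AbsolutelyContinuousOnInterval g a b)
    (h : ∀ s ∈ uIcc a b, ∀ t ∈ uIcc a b, dist (f s) (f t) ≤ K * dist (g s) (g t)) :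
    AbsolutelyContinuousOnInterval f a b := by
  unfold AbsolutelyContinuousOnInterval at hg ⊢
  have hg' := hg.const_mul K
  rw [mul_zero] at hg'
  refine squeeze_zero' (Eventually.of_forall fun E => Finset.sum_nonneg fun _ _ => dist_nonneg)
    ?_ hg'
  refine eventually_inf_principal.2 (Eventually.of_forall fun E hE => ?_)
  rw [Finset.mul_sum]
  exact Finset.sum_le_sum fun i hi => h _ (hE.1 i hi).1 _ (hE.1 i hi).2

lemma absolutelyContinuousOnInterval_comp {X Y : Type*} [PseudoMetricSpace X]
    [PseudoMetricSpace Y] {Ψ : X → Y} {y : ℝ → X} {a b : ℝ} {K : NNReal}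
    (hΨ : LipschitzOnWith K Ψ (y '' uIcc a b)) (hy : AbsolutelyContinuousOnInterval y a b) :
    AbsolutelyContinuousOnInterval (fun t => Ψ (y t)) a b :=
  absolutelyContinuousOnInterval_of_dist_le hy fun _ hs _ ht =>
    hΨ.dist_le_mul _ (mem_image_of_mem y hs) _ (mem_image_of_mem y ht)

variable {V : Type*} [NormedAddCommGroup V] [NormedSpace ℝ V] {v : ℝ → V} {a b : ℝ}

lemma absolutelyContinuousOnInterval_primitive (hv : IntervalIntegrable v volume a b) (c : V) :
    AbsolutelyContinuousOnInterval (fun t => c + ∫ r in a..t, v r) a b := by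
  refine absolutelyContinuousOnInterval_of_dist_le (K := 1)
    (hv.norm.absolutelyContinuousOnInterval_intervalIntegral left_mem_uIcc) fun s hs t ht => ?_
  have hsub : ∀ {x}, x ∈ uIcc a b → IntervalIntegrable v volume a x := fun hx =>
    hv.mono_set (uIcc_subset_uIcc_left hx)
  rw [one_mul, dist_eq_norm, dist_eq_norm, add_sub_add_left_eq_sub,
    intervalIntegral.integral_interval_sub_left (hsub hs) (hsub ht),
    intervalIntegral.integral_interval_sub_left (hsub hs).norm (hsub ht).norm]
  exact intervalIntegral.norm_integral_le_abs_integral_norm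

theorem integral_fderiv_comp_primitive [CompleteSpace V] (hv : IntervalIntegrable v volume a b)
    (c : V) {Ψ : V → ℝ} (hΨ : ∀ t ∈ uIcc a b, ContDiffAt ℝ 1 Ψ (c + ∫ r in a..t, v r)) :
    ∫ t in a..b, fderiv ℝ Ψ (c + ∫ r in a..t, v r) (v t) = Ψ (c + ∫ r in a..b, v r) - Ψ c := by
  set y : ℝ → V := fun t => c + ∫ r in a..t, v r
  have hy : AbsolutelyContinuousOnInterval y a b := absolutelyContinuousOnInterval_primitive hv c
  obtain ⟨K, hK⟩ : ∃ K, LipschitzOnWith K Ψ (y '' uIcc a b) := by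
    refine LocallyLipschitzOn.exists_lipschitzOnWith_of_compact
      (isCompact_uIcc.image_of_continuousOn hy.continuousOn) ?_
    rintro _ ⟨t, ht, rfl⟩
    obtain ⟨K, s, hs, h⟩ := (hΨ t ht).exists_lipschitzOnWith
    exact ⟨K, s, mem_nhdsWithin_of_mem_nhds hs, h⟩
  have hderiv : ∀ᵐ t, t ∈ uIcc a b → deriv (fun t => Ψ (y t)) t = fderiv ℝ Ψ (y t) (v t) := by
    filter_upwards [hv.ae_hasDerivAt_integral] with t ht hmem
    have hyt : HasDerivAt y (v t) t := (ht hmem a left_mem_uIcc).const_add c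
    exact (((hΨ t hmem).differentiableAt one_ne_zero).hasFDerivAt.comp_hasDerivAt t hyt).deriv
  calc ∫ t in a..b, fderiv ℝ Ψ (y t) (v t)
      = ∫ t in a..b, deriv (fun t => Ψ (y t)) t := by
        refine intervalIntegral.integral_congr_ae ?_
        filter_upwards [hderiv] with t ht hmem
        exact (ht (uIoc_subset_uIcc hmem)).symm
    _ = Ψ (y b) - Ψ (y a) := (absolutelyContinuousOnInterval_comp hK hy).integral_deriv_eq_sub
    _ = Ψ (y b) - Ψ c := by simp only [y, intervalIntegral.integral_same, add_zero]

end Primitives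

section Superposition

variable {X V E : Type*} [TopologicalSpace X] [CompactSpace X] [NormedAddCommGroup V]
  [NormedSpace ℝ V] [NormedAddCommGroup E] [NormedSpace ℝ E]

/-- Multiplication of continuous vector-valued functions by a continuous family of operators. -/
def pointwiseApply (D : C(X, V →L[ℝ] E)) : C(X, V) →L[ℝ] C(X, E) :=
  LinearMap.mkContinuous
    { toFun := fun ξ => ⟨fun s => D s (ξ s), by fun_prop⟩
      map_add' := fun ξ ζ => by ext s; simp
      map_smul' := fun c ξ => by ext s; simp } ‖D‖ fun ξ =>
    (ContinuousMap.norm_le _ (by positivity)).2 fun s =>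
      (D s).le_of_opNorm_le_of_le (D.norm_coe_le_norm s) (ξ.norm_coe_le_norm s)

@[simp] lemma pointwiseApply_apply (D : C(X, V →L[ℝ] E)) (ξ : C(X, V)) (s : X) :
    pointwiseApply D ξ s = D s (ξ s) := rfl

lemma hasFDerivAt_pointwiseApply {N : C(X, V) → C(X, E)} {B : X → V → E} {D : C(X, V →L[ℝ] E)}
    (hN : ∀ᶠ ξ in 𝓝 (0 : C(X, V)), ∀ s, N ξ s = B s (ξ s))
    (hB : ∀ ε > 0, ∀ᶠ z in 𝓝 (0 : V), ∀ s, ‖B s z - B s 0 - D s z‖ ≤ ε * ‖z‖) :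
    HasFDerivAt N (pointwiseApply D) 0 := by
  refine HasFDerivAt.of_isLittleO (Asymptotics.IsLittleO.of_bound fun ε hε => ?_)
  obtain ⟨δ, hδ, hball⟩ := Metric.eventually_nhds_iff_ball.1 (hB ε hε)
  filter_upwards [hN, Metric.ball_mem_nhds (0 : C(X, V)) hδ] with ξ hξ hξδ
  rw [mem_ball_zero_iff] at hξδ
  refine (ContinuousMap.norm_le _ (by positivity)).2 fun s => ?_
  have hs : ‖ξ s‖ ≤ ‖ξ‖ := ξ.norm_coe_le_norm s
  simp only [ContinuousMap.sub_apply, hξ s, hN.self_of_nhds s, ContinuousMap.zero_apply, sub_zero,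
    pointwiseApply_apply]
  exact (hball _ (mem_ball_zero_iff.2 (hs.trans_lt hξδ)) s).trans
    (mul_le_mul_of_nonneg_left hs hε.le)

end Superposition

lemma eventually_norm_sub_fderiv_le {V E : Type*} [NormedAddCommGroup V] [NormedSpace ℝ V]
    [NormedAddCommGroup E] [NormedSpace ℝ E] {f : V → E} {p : V} (hf : ContDiffAt ℝ 1 f p) {ε : ℝ}
    (hε : 0 < ε) :
    ∀ᶠ z : V × V in 𝓝 (0, p), ‖f (z.2 + z.1) - f z.2 - fderiv ℝ f z.2 z.1‖ ≤ ε * ‖z.1‖ := by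
  have hincr := (hf.hasStrictFDerivAt one_ne_zero).isLittleO.def (half_pos hε)
  have hderiv : ∀ᶠ q in 𝓝 p, ‖fderiv ℝ f q - fderiv ℝ f p‖ < ε / 2 := by
    have hcont : ContinuousAt (fderiv ℝ f) p :=
      (hf.fderiv_right (m := 0) (by norm_num)).continuousAt
    simpa only [dist_eq_norm] using Metric.tendsto_nhds.1 hcont (ε / 2) (half_pos hε)
  have hshift : Tendsto (fun z : V × V => (z.2 + z.1, z.2)) (𝓝 (0, p)) (𝓝 (p, p)) :=
    Continuous.tendsto' (by fun_prop) _ _ (by simp)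
  filter_upwards [hshift.eventually hincr, (continuous_snd.tendsto (0, p)).eventually hderiv]
    with ⟨z, q⟩ hz hq
  simp only [add_sub_cancel_left] at hz
  calc ‖f (q + z) - f q - fderiv ℝ f q z‖
      = ‖(f (q + z) - f q - fderiv ℝ f p z) - (fderiv ℝ f q - fderiv ℝ f p) z‖ := by
        congr 1
        simp only [sub_apply]
        abel
    _ ≤ ε / 2 * ‖z‖ + ε / 2 * ‖z‖ :=
        (norm_sub_le _ _).trans
          (add_le_add hz (ContinuousLinearMap.le_of_opNorm_le _ hq.le z))
    _ = ε * ‖z‖ := by ring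

lemma proj_surjective : Function.Surjective proj := by
  intro q
  choose r hr using fun i => QuotientAddGroup.mk_surjective (q i)
  exact ⟨WithLp.toLp 2 r, funext hr⟩

lemma isOpenMap_proj : IsOpenMap proj := by
  have h : IsOpenMap (fun (r : Fin 2 → ℝ) i => ((r i : ℝ) : UnitAddCircle)) :=
    IsOpenMap.piMap (fun _ => QuotientAddGroup.isOpenMap_coe) (by simp)
  exact h.comp (PiLp.homeomorph 2 (fun _ : Fin 2 => ℝ)).isOpenMap

lemma continuousAt_of_comp_proj {E : Type*} [TopologicalSpace E] {A : Torus → E} {p : Plane}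
    (h : ContinuousAt (fun p => A (proj p)) p) : ContinuousAt A (proj p) := by
  rwa [ContinuousAt, ← isOpenMap_proj.map_nhds_eq continuous_proj.continuousAt, tendsto_map'_iff]

section TorusDeriv

variable {E : Type*} [NormedAddCommGroup E] [NormedSpace ℝ E]

/-- The derivative of a function on the torus, in the Cartesian frame. -/
def torusDeriv (A : Torus → E) (q : Torus) : Plane →L[ℝ] E :=
  fderiv ℝ (fun p => A (proj p)) (Function.surjInv proj_surjective q)

lemma torusDeriv_proj (A : Torus → E) (p : Plane) :
    torusDeriv A (proj p) = fderiv ℝ (fun p => A (proj p)) p := by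
  set d := Function.surjInv proj_surjective (proj p) - p with hd
  have hd0 : proj d = 0 := by
    rw [hd, sub_eq_add_neg, proj_add, proj_neg, Function.surjInv_eq proj_surjective,
      add_neg_cancel]
  have hperiodic : (fun z => A (proj (z + d))) = fun z => A (proj z) := by
    ext z; rw [proj_add, hd0, add_zero]
  have h := fderiv_comp_add_right (𝕜 := ℝ) (f := fun z => A (proj z)) (x := p) d
  rw [hperiodic, hd, add_sub_cancel] at h
  exact h.symm

/-- `A` is of class `C¹` on the open subset `O` of the torus: its lift to the plane is. -/
structure IsC1On (A : Torus → E) (O : Set Torus) : Prop where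
  isOpen : IsOpen O
  contDiffOn : ContDiffOn ℝ 1 (fun p => A (proj p)) (proj ⁻¹' O)

namespace IsC1On

variable {A : Torus → E} {O : Set Torus}

lemma contDiffAt (hA : IsC1On A O) {p : Plane} (hp : proj p ∈ O) :
    ContDiffAt ℝ 1 (fun p => A (proj p)) p :=
  hA.contDiffOn.contDiffAt ((hA.isOpen.preimage continuous_proj).mem_nhds hp)

lemma continuousAt (hA : IsC1On A O) {q : Torus} (hq : q ∈ O) : ContinuousAt A q := by
  obtain ⟨p, rfl⟩ := proj_surjective q
  exact continuousAt_of_comp_proj (hA.contDiffAt hq).continuousAt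

lemma continuousAt_torusDeriv (hA : IsC1On A O) {q : Torus} (hq : q ∈ O) :
    ContinuousAt (torusDeriv A) q := by
  obtain ⟨p, rfl⟩ := proj_surjective q
  refine continuousAt_of_comp_proj ?_
  simp only [torusDeriv_proj]
  exact ((hA.contDiffAt hq).fderiv_right (m := 0) (by norm_num)).continuousAt

lemma eventually_norm_sub_torusDeriv_le (hA : IsC1On A O) {q : Torus} (hq : q ∈ O) {ε : ℝ}
    (hε : 0 < ε) : ∀ᶠ z : Plane × Torus in 𝓝 (0, q),
      ‖A (z.2 + proj z.1) - A z.2 - torusDeriv A z.2 z.1‖ ≤ ε * ‖z.1‖ := by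
  obtain ⟨p, rfl⟩ := proj_surjective q
  have hmap : map (Prod.map id proj) (𝓝 ((0 : Plane), p)) = 𝓝 (0, proj p) :=
    (IsOpenMap.id.prodMap isOpenMap_proj).map_nhds_eq
      (continuous_id.prodMap continuous_proj).continuousAt
  rw [← hmap, eventually_map]
  filter_upwards [eventually_norm_sub_fderiv_le (hA.contDiffAt hq) hε] with z hz
  simpa only [Prod.map_fst, Prod.map_snd, id_eq, torusDeriv_proj, ← proj_add] using hz

end IsC1On

variable {X : Type*} [TopologicalSpace X]

/-- The composition of a function `A` of class `C¹` on `O` with a continuous map into `O`. -/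
def IsC1On.along {A : Torus → E} {O : Set Torus} (hA : IsC1On A O) {x : C(X, Torus)}
    (hx : ∀ s, x s ∈ O) : C(X, E) where
  toFun s := A (x s)
  continuous_toFun := continuous_iff_continuousAt.2 fun s =>
    (hA.continuousAt (hx s)).comp x.continuous.continuousAt

/-- The composition of the derivative of a function of class `C¹` on `O` with a continuous map
into `O`. -/
def IsC1On.derivAlong {A : Torus → E} {O : Set Torus} (hA : IsC1On A O) {x : C(X, Torus)}
    (hx : ∀ s, x s ∈ O) : C(X, Plane →L[ℝ] E) where
  toFun s := torusDeriv A (x s)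
  continuous_toFun := continuous_iff_continuousAt.2 fun s =>
    (hA.continuousAt_torusDeriv (hx s)).comp x.continuous.continuousAt

/-- The superposition operator `ξ ↦ A (x + ξ)`, extended by `0` to those `ξ` for which `A (x + ξ)`
is not continuous. -/
def superposition (A : Torus → E) (x : C(X, Torus)) (ξ : C(X, Plane)) : C(X, E) :=
  open Classical in
  if h : Continuous fun s => A (x s + proj (ξ s)) then ⟨_, h⟩ else 0

variable [CompactSpace X] {A : Torus → E} {O : Set Torus} {x : C(X, Torus)}

lemma eventually_add_proj_mem (hO : IsOpen O) (hx : ∀ s, x s ∈ O) :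
    ∀ᶠ ξ in 𝓝 (0 : C(X, Plane)), ∀ s, x s + proj (ξ s) ∈ O := by
  have hcont : Continuous fun ξ : C(X, Plane) =>
      x + ContinuousMap.comp ⟨proj, continuous_proj⟩ ξ :=
    continuous_const.add (ContinuousMap.continuous_postcomp _)
  have hzero : x + ContinuousMap.comp ⟨proj, continuous_proj⟩ (0 : C(X, Plane)) = x := by
    ext1 s
    simp [proj_zero]
  have hmem := hcont.tendsto' 0 x hzero |>.eventually
    (ContinuousMap.eventually_mapsTo isCompact_univ hO fun s _ => hx s)
  filter_upwards [hmem] with ξ hξ s using hξ (mem_univ s)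

lemma eventually_superposition_apply (hA : IsC1On A O) (hx : ∀ s, x s ∈ O) :
    ∀ᶠ ξ in 𝓝 (0 : C(X, Plane)), ∀ s, superposition A x ξ s = A (x s + proj (ξ s)) := by
  filter_upwards [eventually_add_proj_mem hA.isOpen hx] with ξ hξ s
  have hcont : Continuous fun s => A (x s + proj (ξ s)) :=
    (hA.along (x := x + ContinuousMap.comp ⟨proj, continuous_proj⟩ ξ) hξ).continuous
  rw [superposition, dif_pos hcont, ContinuousMap.coe_mk]

lemma superposition_zero (hA : IsC1On A O) (hx : ∀ s, x s ∈ O) :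
    superposition A x 0 = hA.along hx := by
  ext1 s
  rw [(eventually_superposition_apply hA hx).self_of_nhds s, ContinuousMap.zero_apply, proj_zero,
    add_zero]
  rfl

theorem hasFDerivAt_superposition (hA : IsC1On A O) (hx : ∀ s, x s ∈ O) :
    HasFDerivAt (superposition A x) (pointwiseApply (hA.derivAlong hx)) 0 := by
  refine hasFDerivAt_pointwiseApply (B := fun s z => A (x s + proj z))
    (eventually_superposition_apply hA hx) fun ε hε => ?_
  have hunif : ∀ᶠ z in 𝓝 (0 : Plane), ∀ q ∈ range x,
      ‖A (q + proj z) - A q - torusDeriv A q z‖ ≤ ε * ‖z‖ :=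
    (isCompact_range x.continuous).eventually_forall_of_forall_eventually <| by
      rintro _ ⟨s, rfl⟩
      exact hA.eventually_norm_sub_torusDeriv_le (hx s) hε
  filter_upwards [hunif] with z hz s
  rw [proj_zero, add_zero]
  exact hz _ (mem_range_self s)

end TorusDeriv

section H1

lemma eq_zero_of_proj_eq_zero {p : Plane} (h : proj p = 0) (hp : ‖p‖ < 1) : p = 0 := by
  ext i
  obtain ⟨n, hn⟩ := (AddCircle.coe_eq_zero_iff 1).1 (congrFun h i)
  have hi : |(n : ℝ)| < 1 := by
    simpa only [zsmul_eq_mul, mul_one, ← hn, Real.norm_eq_abs] using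
      (PiLp.norm_apply_le p i).trans_lt hp
  have hn0 : n = 0 := Int.abs_lt_one_iff.1 (by exact_mod_cast hi)
  simp [← hn, hn0]

instance : IsProbabilityMeasure (volume : Measure UnitAddCircle) :=
  ⟨UnitAddCircle.measure_univ⟩

lemma integral_norm_le (v : L2) : ∫ s : UnitAddCircle, ‖v s‖ ≤ ‖v‖ := by
  rw [Lp.norm_def, integral_norm_eq_lintegral_enorm (Lp.aestronglyMeasurable v),
    ← eLpNorm_one_eq_lintegral_enorm]
  exact ENNReal.toReal_mono (Lp.eLpNorm_ne_top v)
    (eLpNorm_le_eLpNorm_of_exponent_le (by norm_num) (Lp.aestronglyMeasurable v))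

lemma norm_displacement_le (v : L2) {t : ℝ} (ht : t ∈ Icc (0 : ℝ) 1) :
    ‖displacement v t‖ ≤ ‖v‖ :=
  calc ‖displacement v t‖ ≤ ∫ r in (0 : ℝ)..t, ‖v (r : UnitAddCircle)‖ :=
        intervalIntegral.norm_integral_le_integral_norm ht.1
    _ ≤ ∫ r in (0 : ℝ)..1, ‖v (r : UnitAddCircle)‖ :=
        intervalIntegral.integral_mono_interval le_rfl ht.1 ht.2
          (Eventually.of_forall fun _ => norm_nonneg _) (intervalIntegrable_vel v 0 1).norm
    _ = ∫ s : UnitAddCircle, ‖v s‖ := by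
        rw [← UnitAddCircle.intervalIntegral_preimage 0 (fun s => ‖v s‖), zero_add]
    _ ≤ ‖v‖ := integral_norm_le v

lemma displacement_add_one (v : L2) (t : ℝ) :
    displacement v (t + 1) = displacement v t + displacement v 1 := by
  have hper : Function.Periodic (fun r : ℝ => v (r : UnitAddCircle)) 1 := by intro r; simp
  unfold displacement
  rw [← intervalIntegral.integral_add_adjacent_intervals (intervalIntegrable_vel v 0 t)
    (intervalIntegrable_vel v t (t + 1)), hper.intervalIntegral_add_eq t 0, zero_add]

lemma continuous_displacement (v : L2) : Continuous (displacement v) :=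
  intervalIntegral.continuous_primitive (intervalIntegrable_vel v) 0

lemma exists_coe_eq (s : UnitAddCircle) : ∃ t ∈ Icc (0 : ℝ) 1, (t : UnitAddCircle) = s := by
  simpa using (AddCircle.coe_image_Icc_eq 1 (0 : ℝ)).ge (mem_univ s)

/-- The vector field along loops with initial value `r` and derivative `v`. -/
def primitiveField (r : Plane) (v : L2) (hv : displacement v 1 = 0) : H1Field :=
  have hper : Function.Periodic (fun t => r + displacement v t) 1 := fun t => by
    simp only [displacement_add_one, hv, add_zero]
  ⟨(⟨hper.lift, continuous_coinduced_dom.2 (continuous_const.add (continuous_displacement v))⟩, v),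
    fun t => by
      change r + displacement v t = r + displacement v 0 + displacement v t
      simp [displacement]⟩

lemma primitiveField_coe (r : Plane) (v : L2) (hv : displacement v 1 = 0) (t : ℝ) :
    (primitiveField r v hv).1.1 (t : UnitAddCircle) = r + displacement v t := rfl

lemma norm_primitiveField_le (r : Plane) (v : L2) (hv : displacement v 1 = 0) :
    ‖primitiveField r v hv‖ ≤ ‖r‖ + ‖v‖ := by
  refine max_le ((ContinuousMap.norm_le _ (by positivity)).2 fun s => ?_)
    (le_add_of_nonneg_left (norm_nonneg r))
  obtain ⟨t, ht, rfl⟩ := exists_coe_eq s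
  calc ‖(primitiveField r v hv).1.1 t‖ = ‖r + displacement v t‖ := rfl
    _ ≤ ‖r‖ + ‖displacement v t‖ := norm_add_le _ _
    _ ≤ ‖r‖ + ‖v‖ := by gcongr; exact norm_displacement_le v ht

lemma projField_primitiveField {y : H1Loop} {r : Plane} (hr : proj r = y.1.1 0)
    (hy : displacement y.1.2 1 = 0) : projField (primitiveField r y.1.2 hy) = y := by
  refine Subtype.ext (Prod.ext (ContinuousMap.ext fun s => ?_) rfl)
  obtain ⟨t, -, rfl⟩ := exists_coe_eq s
  rw [y.2 t, ← hr, ← proj_add, ← primitiveField_coe r y.1.2 hy]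
  rfl

lemma projField_add (ξ ζ : H1Field) : projField (ξ + ζ) = projField ξ + projField ζ :=
  Subtype.ext (Prod.ext (ContinuousMap.ext fun _ => proj_add _ _) rfl)

lemma projField_zero : projField 0 = 0 :=
  Subtype.ext (Prod.ext (ContinuousMap.ext fun _ => proj_zero) rfl)

lemma continuous_projField : Continuous projField :=
  (((ContinuousMap.continuous_postcomp _).comp (continuous_fst.comp continuous_subtype_val)).prodMk
    (continuous_snd.comp continuous_subtype_val)).subtype_mk _

lemma injOn_projField : InjOn projField (Metric.ball 0 (1 / 2)) := by
  intro ξ hξ ζ hζ h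
  rw [mem_ball_zero_iff (E := H1Field)] at hξ hζ
  refine Subtype.ext (Prod.ext (ContinuousMap.ext fun s => ?_)
    (congrArg (fun y : H1Loop => y.1.2) h))
  have hproj : proj (ξ.1.1 s) = proj (ζ.1.1 s) :=
    congrArg (fun y : H1Loop => y.1.1 s) h
  have hle : ∀ χ : H1Field, ‖χ.1.1 s‖ ≤ ‖χ‖ := fun χ =>
    (χ.1.1.norm_coe_le_norm s).trans (le_max_left _ _)
  refine sub_eq_zero.1 (eq_zero_of_proj_eq_zero ?_ ?_)
  · rw [sub_eq_add_neg, proj_add, proj_neg, hproj, add_neg_cancel]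
  · linarith [norm_sub_le (ξ.1.1 s) (ζ.1.1 s), hle ξ, hle ζ]

lemma map_projField_nhds_zero : map projField (𝓝 0) = 𝓝 0 := by
  refine le_antisymm (continuous_projField.tendsto' _ _ projField_zero) ?_
  refine (Metric.nhds_basis_ball.map _).ge_iff.2 fun ε hε => ?_
  have hvel : ∀ᶠ y : H1Loop in 𝓝 0, ‖y.1.2‖ < min (ε / 2) 1 :=
    (continuous_snd.comp continuous_subtype_val).norm.tendsto' (0 : H1Loop) 0 norm_zero
      |>.eventually (gt_mem_nhds (by positivity))
  have hinit : ∀ᶠ y : H1Loop in 𝓝 0, y.1.1 0 ∈ proj '' Metric.ball 0 (ε / 2) :=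
    (((continuous_eval_const (F := C(UnitAddCircle, Torus)) 0).comp
      (continuous_fst.comp continuous_subtype_val)).tendsto' (0 : H1Loop) (proj 0)
        proj_zero.symm).eventually
      (isOpenMap_proj.image_mem_nhds (Metric.ball_mem_nhds _ (half_pos hε)))
  filter_upwards [hvel, hinit] with y hvel ⟨r, hr, hry⟩
  obtain ⟨hvel₁, hvel₂⟩ := lt_min_iff.1 hvel
  have hclosed : displacement y.1.2 1 = 0 := by
    refine eq_zero_of_proj_eq_zero ?_
      ((norm_displacement_le _ ⟨zero_le_one, le_rfl⟩).trans_lt hvel₂)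
    have hy := y.2 1
    rwa [AddCircle.coe_period, left_eq_add] at hy
  refine ⟨primitiveField r y.1.2 hclosed, ?_, projField_primitiveField hry hclosed⟩
  refine (mem_ball_zero_iff (E := H1Field)).2 ?_
  rw [mem_ball_zero_iff] at hr
  linarith [norm_primitiveField_le r y.1.2 hclosed]

end H1

section Chart

lemma period_pos (γ : Loops) : 0 < γ.period := γ.2.2

variable {γ : Loops} {h : Tangent}

lemma period_chart (hh : 0 < γ.period + h.2) : (chart γ h).period = γ.period + h.2 :=
  congrArg Subtype.val (dif_pos hh)

lemma Loops.ext {β γ : Loops} (h : β.1 = γ.1) (hT : β.period = γ.period) : β = γ :=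
  Prod.ext h (Subtype.ext hT)

lemma chart_zero (γ : Loops) : chart γ 0 = γ :=
  Loops.ext (by simp only [chart, Prod.fst_zero, projField_zero, add_zero])
    (by rw [period_chart] <;> simp [period_pos γ])

lemma chart_chart {h' : Tangent} (hh : 0 < γ.period + h.2)
    (hh' : 0 < γ.period + h.2 + h'.2) : chart (chart γ h) h' = chart γ (h + h') := by
  refine Loops.ext (by simp only [chart, Prod.fst_add, projField_add, add_assoc]) ?_
  have hadd : γ.period + (h + h').2 = γ.period + h.2 + h'.2 := by rw [Prod.snd_add, add_assoc]
  rw [period_chart (by rwa [period_chart hh]), period_chart hh, period_chart (by rwa [hadd]), hadd]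

lemma eventually_period_add_pos (hh : 0 < γ.period + h.2) :
    ∀ᶠ h' in 𝓝 h, 0 < γ.period + h'.2 :=
  (continuous_const.add continuous_snd).tendsto h |>.eventually (lt_mem_nhds hh)

lemma eventually_chart_chart (hh : 0 < γ.period + h.2) :
    ∀ᶠ h' in 𝓝 (0 : Tangent), chart (chart γ h) h' = chart γ (h + h') := by
  filter_upwards [eventually_period_add_pos (γ := chart γ h) (h := 0)
    (by simpa using period_pos (chart γ h))] with h' hh'
  exact chart_chart hh (by rwa [period_chart hh] at hh')

lemma eventually_period_chart (γ : Loops) :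
    ∀ᶠ h in 𝓝 (0 : Tangent), (chart γ h).period = γ.period + h.2 := by
  filter_upwards [eventually_period_add_pos (γ := γ) (h := 0) (by simpa using period_pos γ)]
    with h hh using period_chart hh

lemma continuousAt_chart_zero (γ : Loops) : ContinuousAt (chart γ) 0 := by
  refine ContinuousAt.prodMk
    (continuous_const.add (continuous_projField.comp continuous_fst)).continuousAt
    (Topology.IsInducing.subtypeVal.continuousAt_iff.2 ?_)
  exact (continuous_const.add continuous_snd).continuousAt.congr
    ((eventually_period_chart γ).mono fun _ => Eq.symm)

lemma map_chart_nhds_zero (γ : Loops) : map (chart γ) (𝓝 0) = 𝓝 γ := by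
  refine le_antisymm ((continuousAt_chart_zero γ).tendsto.trans_eq (by rw [chart_zero])) ?_
  refine (Metric.nhds_basis_ball.map _).ge_iff.2 fun ε hε => ?_
  have hloop : ∀ᶠ β : Loops in 𝓝 γ, β.1 - γ.1 ∈ projField '' Metric.ball 0 ε :=
    (continuous_fst.sub continuous_const).tendsto' γ 0 (sub_self _) |>.eventually
      (map_projField_nhds_zero ▸ image_mem_map (Metric.ball_mem_nhds 0 hε))
  have hperiod : ∀ᶠ β : Loops in 𝓝 γ, |β.period - γ.period| < ε :=
    (((continuous_subtype_val.comp continuous_snd).sub continuous_const).abs.tendsto' γ 0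
      (by simp [Loops.period])).eventually (gt_mem_nhds hε)
  filter_upwards [hloop, hperiod] with β ⟨ξ, hξ, hξβ⟩ hT
  refine ⟨(ξ, β.period - γ.period), ?_, Loops.ext (by simp [chart, hξβ]) ?_⟩
  · exact (mem_ball_zero_iff (E := Tangent)).2 (max_lt ((mem_ball_zero_iff (E := H1Field)).1 hξ) hT)
  · rw [period_chart (by simpa using period_pos β), add_sub_cancel]

lemma map_chart_nhds (hh : 0 < γ.period + h.2) : map (chart γ) (𝓝 h) = 𝓝 (chart γ h) := by
  rw [← map_chart_nhds_zero, map_congr (eventually_chart_chart hh), ← map_add_left_nhds_zero,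
    map_map]
  rfl

/-- A ball of tangent vectors at `γ` on which the chart centred at `γ` is an open embedding. -/
def chartBall (γ : Loops) : Set Tangent := Metric.ball 0 (min (1 / 2) γ.period)

lemma period_add_pos_of_mem_chartBall (hh : h ∈ chartBall γ) : 0 < γ.period + h.2 := by
  have hlt : ‖h‖ < γ.period := ((mem_ball_zero_iff (E := Tangent)).1 hh).trans_le (min_le_right _ _)
  have hle : |h.2| ≤ ‖h‖ := norm_snd_le h
  linarith [neg_abs_le h.2]

lemma zero_mem_chartBall (γ : Loops) : (0 : Tangent) ∈ chartBall γ :=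
  Metric.mem_ball_self (lt_min one_half_pos (period_pos γ))

lemma isOpen_image_chartBall (γ : Loops) : IsOpen (chart γ '' chartBall γ) := by
  refine isOpen_iff_mem_nhds.2 ?_
  rintro _ ⟨h, hh, rfl⟩
  rw [← map_chart_nhds (period_add_pos_of_mem_chartBall hh)]
  exact image_mem_map (Metric.isOpen_ball.mem_nhds hh)

lemma injOn_chart (γ : Loops) : InjOn (chart γ) (chartBall γ) := by
  intro h hh h' hh' heq
  have hfst : ∀ {k}, k ∈ chartBall γ → k.1 ∈ Metric.ball (0 : H1Field) (1 / 2) := fun hk =>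
    (mem_ball_zero_iff (E := H1Field)).2 ((norm_fst_le _).trans_lt
      (((mem_ball_zero_iff (E := Tangent)).1 hk).trans_le (min_le_left _ _)))
  refine Prod.ext (injOn_projField (hfst hh) (hfst hh')
    (add_left_cancel (congrArg Prod.fst heq))) ?_
  have hT := congrArg Loops.period heq
  rwa [period_chart (period_add_pos_of_mem_chartBall hh),
    period_chart (period_add_pos_of_mem_chartBall hh'), add_right_inj] at hT

lemma hasFDerivAt_comp_chart_iff {f : Loops → ℝ} (hh : 0 < γ.period + h.2) {L : Tangent →L[ℝ] ℝ} :
    HasFDerivAt (fun k => f (chart (chart γ h) k)) L 0 ↔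
      HasFDerivAt (fun k => f (chart γ k)) L h := by
  have hcongr : (fun k => f (chart (chart γ h) k)) =ᶠ[𝓝 0] fun k => f (chart γ (h + k)) :=
    (eventually_chart_chart hh).mono fun k hk => congrArg f hk
  rw [hcongr.hasFDerivAt_iff]
  have hshift := hasFDerivAt_comp_add_left (𝕜 := ℝ) (E := Tangent) (f := fun k => f (chart γ k))
    (f' := L) (x := 0) h
  rwa [add_zero] at hshift

end Chart

section PrimitiveOn

variable {η : OneForm} {γ : Loops}

lemma IsPrimitiveOn.hasFDerivAt_comp_chart {f : Loops → ℝ} {W : Set Loops}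
    (hf : IsPrimitiveOn η f W) {h : Tangent} (hh : 0 < γ.period + h.2) (hW : chart γ h ∈ W) :
    ∃ L : Tangent →L[ℝ] ℝ,
      HasFDerivAt (fun k => f (chart γ k)) L h ∧ ∀ k, L k = η (chart γ h) k := by
  obtain ⟨L, hL, hLη⟩ := hf _ hW
  exact ⟨L, (hasFDerivAt_comp_chart_iff hh).1 hL, hLη⟩

lemma IsPrimitiveOn.of_hasFDerivAt {Φ : Tangent → ℝ}
    (hΦ : ∀ h ∈ chartBall γ, ∃ L : Tangent →L[ℝ] ℝ,
      HasFDerivAt Φ L h ∧ ∀ k, L k = η (chart γ h) k) :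
    IsPrimitiveOn η (Φ ∘ Function.invFunOn (chart γ) (chartBall γ)) (chart γ '' chartBall γ) := by
  rintro _ ⟨h, hh, rfl⟩
  obtain ⟨L, hL, hLη⟩ := hΦ h hh
  refine ⟨L, (hasFDerivAt_comp_chart_iff (period_add_pos_of_mem_chartBall hh)).2 ?_, hLη⟩
  refine HasFDerivAt.congr_of_eventuallyEq (E := Tangent) hL ?_
  filter_upwards [Metric.isOpen_ball.mem_nhds hh] with k hk
  exact congrArg Φ ((injOn_chart γ).leftInvOn_invFunOn hk)

theorem IsPrimitiveOn.eventually_sub_eq {f₁ f₂ : Loops → ℝ} {W₁ W₂ : Set Loops}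
    (hf₁ : IsPrimitiveOn η f₁ W₁) (hf₂ : IsPrimitiveOn η f₂ W₂) (h₁ : W₁ ∈ 𝓝 γ)
    (h₂ : W₂ ∈ 𝓝 γ) : ∀ᶠ β in 𝓝 γ, f₁ β - f₁ γ = f₂ β - f₂ γ := by
  rw [← map_chart_nhds_zero γ] at h₁ h₂ ⊢
  have hmem : ∀ᶠ h in 𝓝 (0 : Tangent),
      (chart γ h ∈ W₁ ∧ chart γ h ∈ W₂) ∧ 0 < γ.period + h.2 :=
    ((eventually_map.1 h₁).and (eventually_map.1 h₂)).and
      (eventually_period_add_pos (by simpa using period_pos γ))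
  obtain ⟨ε, hε, hball⟩ := (Metric.eventually_nhds_iff_ball (α := Tangent)).1 hmem
  have hderiv : ∀ h ∈ Metric.ball (0 : Tangent) ε, ∃ L : Tangent →L[ℝ] ℝ,
      HasFDerivAt (fun k => f₁ (chart γ k)) L h ∧ HasFDerivAt (fun k => f₂ (chart γ k)) L h := by
    intro h hh
    obtain ⟨⟨hW₁, hW₂⟩, hT⟩ := hball h hh
    obtain ⟨L₁, hL₁, hη₁⟩ := hf₁.hasFDerivAt_comp_chart hT hW₁
    obtain ⟨L₂, hL₂, hη₂⟩ := hf₂.hasFDerivAt_comp_chart hT hW₂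
    obtain rfl : L₁ = L₂ := ContinuousLinearMap.ext fun k => (hη₁ k).trans (hη₂ k).symm
    exact ⟨L₁, hL₁, hL₂⟩
  choose! L hL₁ hL₂ using hderiv
  obtain ⟨c, hc⟩ := IsOpen.exists_eq_add_of_fderiv_eq (𝕜 := ℝ) (E := Tangent) Metric.isOpen_ball
    (convex_ball (0 : Tangent) ε).isPreconnected
    (fun k hk => (hL₁ k hk).differentiableAt.differentiableWithinAt)
    (fun k hk => (hL₂ k hk).differentiableAt.differentiableWithinAt)
    (fun k hk => (hL₁ k hk).fderiv.trans (hL₂ k hk).fderiv.symm)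
  refine eventually_map.2 ?_
  filter_upwards [Metric.ball_mem_nhds (0 : Tangent) hε] with h hh
  have h₀ : f₁ γ = f₂ γ + c := by simpa only [chart_zero] using hc (Metric.mem_ball_self hε)
  have hₕ : f₁ (chart γ h) = f₂ (chart γ h) + c := hc hh
  rw [h₀, hₕ, add_sub_add_right_eq_sub]

end PrimitiveOn

section Pairing

set_option maxSynthPendingDepth 3

variable {E F G : Type*} [NormedAddCommGroup E] [NormedSpace ℝ E] [NormedAddCommGroup F]
  [NormedSpace ℝ F] [NormedAddCommGroup G] [NormedSpace ℝ G]

/-- The pairing `(a, v) ↦ ∫ B (a, v)` of a continuous and a square-integrable function. -/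
def pairing (B : E →L[ℝ] F →L[ℝ] ℝ) :
    C(UnitAddCircle, E) →L[ℝ] Lp F 2 (volume : Measure UnitAddCircle) →L[ℝ] ℝ :=
  (B.lpPairing volume 2 2).comp (ContinuousMap.toLp 2 volume ℝ)

lemma pairing_apply (B : E →L[ℝ] F →L[ℝ] ℝ) (a : C(UnitAddCircle, E))
    (v : Lp F 2 (volume : Measure UnitAddCircle)) : pairing B a v = ∫ s, B (a s) (v s) := by
  rw [pairing, ContinuousLinearMap.comp_apply, ContinuousLinearMap.lpPairing_eq_integral]
  refine integral_congr_ae ?_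
  filter_upwards [ContinuousMap.coeFn_toLp (p := 2) (𝕜 := ℝ) volume a] with s hs
  rw [hs]

lemma integrable_pairing (B : E →L[ℝ] F →L[ℝ] ℝ) (a : C(UnitAddCircle, E))
    (v : Lp F 2 (volume : Measure UnitAddCircle)) : Integrable (fun s => B (a s) (v s)) := by
  have ha : MemLp a 2 (volume : Measure UnitAddCircle) :=
    (memLp_congr_ae (ContinuousMap.coeFn_toLp (p := 2) (𝕜 := ℝ) volume a)).1 (Lp.memLp _)
  exact memLp_one_iff_integrable.1 (B.memLp_of_bilin 1 ha (Lp.memLp v))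

/-- The action of continuous operator-valued functions on square-integrable functions. -/
def operatorMul : C(UnitAddCircle, F →L[ℝ] G) →L[ℝ] Lp F 2 (volume : Measure UnitAddCircle) →L[ℝ]
    Lp G 2 (volume : Measure UnitAddCircle) :=
  ((ContinuousLinearMap.id ℝ (F →L[ℝ] G)).holderL volume ⊤ 2 2).comp
    (ContinuousMap.toLp ⊤ volume ℝ)

lemma coeFn_operatorMul (a : C(UnitAddCircle, F →L[ℝ] G))
    (v : Lp F 2 (volume : Measure UnitAddCircle)) :
    operatorMul a v =ᵐ[volume] fun s => a s (v s) := by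
  change (ContinuousLinearMap.id ℝ (F →L[ℝ] G)).holder 2 (ContinuousMap.toLp ⊤ volume ℝ a) v
    =ᵐ[volume] _
  filter_upwards [(ContinuousLinearMap.id ℝ (F →L[ℝ] G)).coeFn_holder (r := 2)
    (ContinuousMap.toLp ⊤ volume ℝ a) v, ContinuousMap.coeFn_toLp (p := ⊤) (𝕜 := ℝ) volume a]
    with s hmul ha
  rw [hmul, ha, ContinuousLinearMap.id_apply]

/-- The integral `(a, v) ↦ ∫ a (v, v)` of a continuous family of bilinear forms. -/
def quadraticIntegral (a : C(UnitAddCircle, E →L[ℝ] E →L[ℝ] ℝ))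
    (v : Lp E 2 (volume : Measure UnitAddCircle)) : ℝ :=
  (ContinuousLinearMap.id ℝ (E →L[ℝ] ℝ)).lpPairing volume 2 2 (operatorMul a v) v

lemma quadraticIntegral_eq (a : C(UnitAddCircle, E →L[ℝ] E →L[ℝ] ℝ))
    (v : Lp E 2 (volume : Measure UnitAddCircle)) :
    quadraticIntegral a v = ∫ s, a s (v s) (v s) := by
  rw [quadraticIntegral, ContinuousLinearMap.lpPairing_eq_integral]
  refine integral_congr_ae ?_
  filter_upwards [coeFn_operatorMul a v] with s hs
  rw [hs, ContinuousLinearMap.id_apply]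

lemma integrable_quadratic (a : C(UnitAddCircle, E →L[ℝ] E →L[ℝ] ℝ))
    (v : Lp E 2 (volume : Measure UnitAddCircle)) : Integrable (fun s => a s (v s) (v s)) :=
  memLp_one_iff_integrable.1 <| (ContinuousLinearMap.id ℝ (E →L[ℝ] ℝ)).memLp_of_bilin 1
    ((memLp_congr_ae (coeFn_operatorMul a v)).1 (Lp.memLp _)) (Lp.memLp v)

lemma differentiableAt_quadraticIntegral {H : Type*} [NormedAddCommGroup H] [NormedSpace ℝ H]
    {a : H → C(UnitAddCircle, E →L[ℝ] E →L[ℝ] ℝ)}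
    {v : H → Lp E 2 (volume : Measure UnitAddCircle)} {x : H} (ha : DifferentiableAt ℝ a x)
    (hv : DifferentiableAt ℝ v x) :
    DifferentiableAt ℝ (fun h => quadraticIntegral (a h) (v h)) x :=
  (((((ContinuousLinearMap.id ℝ (E →L[ℝ] ℝ)).lpPairing volume 2 2).differentiableAt.comp x <|
    (operatorMul.differentiableAt.comp x ha).clm_apply hv)).clm_apply hv)

end Pairing

section IntegrationByParts

/-- The standard area form as a continuous bilinear map. -/
def areaCLM : Plane →L[ℝ] Plane →L[ℝ] ℝ :=
  LinearMap.toContinuousLinearMap (LinearMap.toContinuousLinearMap.toLinearMap ∘ₗ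
    LinearMap.mk₂ ℝ area (fun u u' v => by simp [area]; ring) (fun c u v => by simp [area]; ring)
      (fun u v v' => by simp [area]; ring) (fun c u v => by simp [area]; ring))

lemma areaCLM_apply (u v : Plane) : areaCLM u v = area u v := rfl

lemma area_swap (u v : Plane) : area v u = - area u v := by simp [area, mul_comm]

lemma integral_fderiv_along (p q : Plane) (v w : L2) {Ψ : Plane × Plane → ℝ}
    (hΨ : ∀ t, ContDiffAt ℝ 1 Ψ (p + displacement v t, q + displacement w t)) :
    ∫ t in (0 : ℝ)..1, fderiv ℝ Ψ (p + displacement v t, q + displacement w t)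
        (v (t : UnitAddCircle), w (t : UnitAddCircle))
      = Ψ (p + displacement v 1, q + displacement w 1) - Ψ (p, q) := by
  have hint : ∀ b, IntervalIntegrable
      (fun t : ℝ => (v (t : UnitAddCircle), w (t : UnitAddCircle))) volume 0 b := fun b =>
    ⟨(intervalIntegrable_vel v 0 b).1.prodMk (intervalIntegrable_vel w 0 b).1,
      (intervalIntegrable_vel v 0 b).2.prodMk (intervalIntegrable_vel w 0 b).2⟩
  have hcurve : ∀ t : ℝ, (p, q) + ∫ r in (0 : ℝ)..t, (v (r : UnitAddCircle), w (r : UnitAddCircle))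
      = (p + displacement v t, q + displacement w t) := fun t => Prod.ext
    (congrArg (p + ·) ((ContinuousLinearMap.fst ℝ Plane Plane).intervalIntegral_comp_comm
      (hint t)).symm)
    (congrArg (q + ·) ((ContinuousLinearMap.snd ℝ Plane Plane).intervalIntegral_comp_comm
      (hint t)).symm)
  have h := integral_fderiv_comp_primitive (hint 1) (p, q) (Ψ := Ψ)
    (fun t _ => by rw [hcurve]; exact hΨ t)
  simpa only [hcurve] using h

lemma H1Field.displacement_one (ξ : H1Field) : displacement ξ.1.2 1 = 0 := by
  have h := ξ.2 1
  rwa [AddCircle.coe_period, left_eq_add] at h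

lemma H1Field.apply_coe (ξ : H1Field) (t : ℝ) :
    ξ.1.1 0 + displacement ξ.1.2 t = ξ.1.1 (t : UnitAddCircle) :=
  (ξ.2 t).symm

lemma pairing_area_comm (ξ ζ : H1Field) :
    pairing areaCLM ξ.1.1 ζ.1.2 = pairing areaCLM ζ.1.1 ξ.1.2 := by
  have hderiv : ∀ z : Plane × Plane, fderiv ℝ (fun z : Plane × Plane => areaCLM z.1 z.2) z
      = areaCLM.deriv₂ z := fun z => (areaCLM.isBoundedBilinearMap.hasFDerivAt z).fderiv
  have htotal := integral_fderiv_along (ξ.1.1 0) (ζ.1.1 0) ξ.1.2 ζ.1.2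
    (Ψ := fun z => areaCLM z.1 z.2) (fun t => areaCLM.isBoundedBilinearMap.contDiff.contDiffAt)
  simp only [hderiv, ξ.displacement_one, ζ.displacement_one, ξ.apply_coe, ζ.apply_coe, add_zero,
    sub_self] at htotal
  have hcircle := UnitAddCircle.intervalIntegral_preimage 0 fun s =>
    areaCLM.deriv₂ (ξ.1.1 s, ζ.1.1 s) (ξ.1.2 s, ζ.1.2 s)
  rw [zero_add, htotal] at hcircle
  rw [pairing_apply, pairing_apply, ← sub_eq_zero,
    ← integral_sub (integrable_pairing _ _ _) (integrable_pairing _ _ _), hcircle]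
  refine integral_congr_ae (Eventually.of_forall fun s => ?_)
  simp only [ContinuousLinearMap.coe_deriv₂, areaCLM_apply]
  rw [area_swap (ξ.1.2 s), sub_neg_eq_add]

lemma exists_lift (γ : Loops) :
    ∃ p, ∀ t : ℝ, proj (p + displacement γ.vel t) = γ.loop (t : UnitAddCircle) := by
  obtain ⟨p, hp⟩ := proj_surjective (γ.loop 0)
  exact ⟨p, fun t => by rw [proj_add, hp]; exact (γ.1.2 t).symm⟩

lemma fderiv_form_apply {θ : Torus → Plane →L[ℝ] ℝ} {O : Set Torus} (hθ : IsC1On θ O) {p : Plane}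
    (hp : proj p ∈ O) (z v w : Plane) :
    fderiv ℝ (fun y : Plane × Plane => θ (proj y.1) y.2) (p, z) (v, w)
      = torusDeriv θ (proj p) v z + θ (proj p) w := by
  have hform : HasFDerivAt (fun y : Plane × Plane => θ (proj y.1))
      ((fderiv ℝ (fun p => θ (proj p)) p).comp (ContinuousLinearMap.fst ℝ Plane Plane)) (p, z) :=
    HasFDerivAt.comp (g := fun p => θ (proj p)) (p, z)
      ((hθ.contDiffAt hp).differentiableAt one_ne_zero).hasFDerivAt hasFDerivAt_fst
  rw [(hform.clm_apply hasFDerivAt_snd).fderiv]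
  simp [torusDeriv_proj, add_comm]

lemma integral_torusDeriv_add {θ : Torus → Plane →L[ℝ] ℝ} {O : Set Torus} (hθ : IsC1On θ O)
    {γ : Loops} (hγ : ∀ s, γ.loop s ∈ O) (ξ : H1Field) :
    ∫ s : UnitAddCircle,
      (torusDeriv θ (γ.loop s) (γ.vel s) (ξ.1.1 s) + θ (γ.loop s) (ξ.1.2 s)) = 0 := by
  obtain ⟨p, hp⟩ := exists_lift γ
  have hmem : ∀ t, proj (p + displacement γ.vel t) ∈ O := fun t => by rw [hp]; exact hγ _
  have hstart : proj p = γ.loop 0 := by simpa [displacement] using hp 0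
  have hend : proj (p + displacement γ.vel 1) = γ.loop 0 := by rw [hp, AddCircle.coe_period]
  have hform : ∀ z : Plane × Plane, proj z.1 ∈ O →
      ContDiffAt ℝ 1 (fun z : Plane × Plane => θ (proj z.1) z.2) z := fun z hz =>
    (ContDiffAt.comp (g := fun p => θ (proj p)) z (hθ.contDiffAt hz)
      contDiffAt_fst).clm_apply contDiffAt_snd
  have htotal := integral_fderiv_along p (ξ.1.1 0) γ.vel ξ.1.2
    (Ψ := fun z => θ (proj z.1) z.2) fun t => hform _ (hmem t)
  simp only [fderiv_form_apply hθ (hmem _), ξ.displacement_one, ξ.apply_coe, hend, hstart, add_zero,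
    sub_self, hp] at htotal
  rw [← UnitAddCircle.intervalIntegral_preimage 0 fun s =>
    torusDeriv θ (γ.loop s) (γ.vel s) (ξ.1.1 s) + θ (γ.loop s) (ξ.1.2 s), zero_add]
  exact htotal

end IntegrationByParts

section Action

set_option maxSynthPendingDepth 3

/-- The vector field along the loop underlying a tangent vector. -/
def fieldCLM : Tangent →L[ℝ] C(UnitAddCircle, Plane) :=
  (ContinuousLinearMap.fst ℝ (C(UnitAddCircle, Plane)) L2).comp
    (h1Fields.subtypeL.comp (ContinuousLinearMap.fst ℝ H1Field ℝ))

/-- The weak derivative of the vector field underlying a tangent vector. -/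
def velCLM : Tangent →L[ℝ] L2 :=
  (ContinuousLinearMap.snd ℝ (C(UnitAddCircle, Plane)) L2).comp
    (h1Fields.subtypeL.comp (ContinuousLinearMap.fst ℝ H1Field ℝ))

lemma loop_chart_apply (γ : Loops) (h : Tangent) (s : UnitAddCircle) :
    (chart γ h).loop s = γ.loop s + proj (fieldCLM h s) := rfl

lemma vel_chart (γ : Loops) (h : Tangent) : (chart γ h).vel = γ.vel + velCLM h := rfl

lemma eventually_fieldCLM {P : C(UnitAddCircle, Plane) → Prop} (hP : ∀ᶠ ξ in 𝓝 0, P ξ) :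
    ∀ᶠ h in 𝓝 (0 : Tangent), P (fieldCLM h) :=
  (fieldCLM.continuous.tendsto' 0 0 (map_zero _)).eventually hP

lemma hasFDerivAt_period_chart (γ : Loops) :
    HasFDerivAt (fun h => (chart γ h).period) (ContinuousLinearMap.snd ℝ H1Field ℝ) 0 :=
  HasFDerivAt.congr_of_eventuallyEq (E := Tangent)
    (HasFDerivAt.const_add (E := Tangent) γ.period (hasFDerivAt_snd (E := H1Field)))
    (eventually_period_chart γ)

lemma hasFDerivAt_superposition_chart {E : Type*} [NormedAddCommGroup E] [NormedSpace ℝ E]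
    {A : Torus → E} {O : Set Torus} (hA : IsC1On A O) {γ : Loops} (hγ : ∀ s, γ.loop s ∈ O) :
    HasFDerivAt (fun h => superposition A γ.loop (fieldCLM h))
      ((pointwiseApply (hA.derivAlong hγ)).comp fieldCLM) (0 : Tangent) := by
  refine HasFDerivAt.comp (E := Tangent) (g := superposition A γ.loop) (0 : Tangent) ?_
    fieldCLM.hasFDerivAt
  rw [map_zero]
  exact hasFDerivAt_superposition hA hγ

lemma hasFDerivAt_vel_chart (γ : Loops) : HasFDerivAt (fun h => (chart γ h).vel) velCLM 0 :=
  HasFDerivAt.const_add (E := Tangent) γ.vel velCLM.hasFDerivAt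

lemma TorusMetric.isC1On (g : TorusMetric) : IsC1On g.val univ :=
  ⟨isOpen_univ, (g.smooth.of_le (by norm_num)).contDiffOn⟩

lemma IsPrimitiveAway.isC1On {σ : TwoForm} {q₀ : Torus} {θ : Torus → Plane →L[ℝ] ℝ}
    (hθ : IsPrimitiveAway σ q₀ θ) : IsC1On θ {q | q ≠ q₀} :=
  ⟨isOpen_ne, hθ.smooth.of_le (by norm_num)⟩

lemma integrable_metric (g : TorusMetric) (γ : Loops) :
    Integrable fun s => g.val (γ.loop s) (γ.vel s) (γ.vel s) :=
  integrable_quadratic (g.isC1On.along fun _ => mem_univ _) γ.vel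

lemma differentiableAt_kinetic_chart (g : TorusMetric) (γ : Loops) :
    DifferentiableAt ℝ (fun h => kinetic g (chart γ h)) 0 := by
  have hmetric := hasFDerivAt_superposition_chart g.isC1On (γ := γ) fun _ => mem_univ _
  have henergy := (differentiableAt_quadraticIntegral (H := Tangent) hmetric.differentiableAt
    (hasFDerivAt_vel_chart γ).differentiableAt).const_mul (1 / 2)
  refine DifferentiableAt.congr_of_eventuallyEq (E := Tangent) henergy ?_
  filter_upwards [eventually_fieldCLM
    (eventually_superposition_apply g.isC1On (x := γ.loop) fun _ => mem_univ _)] with h hh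
  simp only [kinetic, quadraticIntegral_eq, hh, loop_chart_apply]

lemma differentiableAt_kineticAction_chart (g : TorusMetric) (k : ℝ) (γ : Loops) :
    DifferentiableAt ℝ (fun h => kineticAction g k (chart γ h)) 0 := by
  have hperiod := (hasFDerivAt_period_chart γ).differentiableAt
  have hquotient : DifferentiableAt ℝ (fun h => kinetic g (chart γ h) / (chart γ h).period) 0 := by
    simp only [div_eq_mul_inv]
    exact DifferentiableAt.mul (E := Tangent) (differentiableAt_kinetic_chart g γ)
      (DifferentiableAt.fun_inv (E := Tangent) hperiod (period_pos _).ne')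
  exact DifferentiableAt.add (E := Tangent) hquotient
    (DifferentiableAt.const_mul (E := Tangent) hperiod k)

/-- The integral of a 1-form over a loop. -/
def formIntegral (θ : Torus → Plane →L[ℝ] ℝ) (γ : Loops) : ℝ :=
  ∫ s : UnitAddCircle, θ (γ.loop s) (γ.vel s)

lemma integrable_form {θ : Torus → Plane →L[ℝ] ℝ} {O : Set Torus} (hθ : IsC1On θ O) {γ : Loops}
    (hγ : ∀ s, γ.loop s ∈ O) (v : L2) : Integrable fun s => θ (γ.loop s) (v s) :=
  integrable_pairing (ContinuousLinearMap.id ℝ (Plane →L[ℝ] ℝ)) (hθ.along hγ) v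

lemma hasFDerivAt_formIntegral_chart {θ : Torus → Plane →L[ℝ] ℝ} {O : Set Torus}
    (hθ : IsC1On θ O) {γ : Loops} (hγ : ∀ s, γ.loop s ∈ O) :
    ∃ L : Tangent →L[ℝ] ℝ, HasFDerivAt (fun h => formIntegral θ (chart γ h)) L 0 ∧ ∀ h, L h =
      (∫ s : UnitAddCircle, torusDeriv θ (γ.loop s) (fieldCLM h s) (γ.vel s))
        + ∫ s : UnitAddCircle, θ (γ.loop s) (velCLM h s) := by
  let Q := pairing (ContinuousLinearMap.id ℝ (Plane →L[ℝ] ℝ))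
  have hderiv := HasFDerivAt.clm_apply (E := Tangent)
    (Q.hasFDerivAt.comp (E := Tangent) 0 (hasFDerivAt_superposition_chart hθ hγ))
    (hasFDerivAt_vel_chart γ)
  refine ⟨_, HasFDerivAt.congr_of_eventuallyEq (E := Tangent) hderiv ?_, fun h => ?_⟩
  · filter_upwards [eventually_fieldCLM (eventually_superposition_apply hθ hγ)] with h hh
    simp only [formIntegral, Q, Function.comp_apply, pairing_apply, hh, loop_chart_apply,
      ContinuousLinearMap.id_apply]
  · simp only [Function.comp_apply, map_zero, superposition_zero hθ hγ, chart_zero, add_apply,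
      ContinuousLinearMap.comp_apply, ContinuousLinearMap.flip_apply, Q, pairing_apply,
      ContinuousLinearMap.id_apply]
    exact add_comm _ _

lemma integrable_apply_continuous_sq (D : C(UnitAddCircle, Plane →L[ℝ] Plane →L[ℝ] ℝ))
    (ξ : C(UnitAddCircle, Plane)) (v : L2) : Integrable (fun s => D s (ξ s) (v s)) :=
  integrable_pairing (ContinuousLinearMap.id ℝ (Plane →L[ℝ] ℝ)) (pointwiseApply D ξ) v

lemma transgression_eq {σ : TwoForm} {q₀ : Torus} {θ : Torus → Plane →L[ℝ] ℝ}
    (hθ : IsPrimitiveAway σ q₀ θ) {γ : Loops} (hγ : γ ∈ avoiding q₀) (h : Tangent) :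
    transgression σ γ h = (∫ s : UnitAddCircle, torusDeriv θ (γ.loop s) (fieldCLM h s) (γ.vel s))
      + ∫ s : UnitAddCircle, θ (γ.loop s) (velCLM h s) := by
  let D := hθ.isC1On.derivAlong hγ
  let Dflip : C(UnitAddCircle, Plane →L[ℝ] Plane →L[ℝ] ℝ) :=
    ⟨fun s => (D s).flip, (ContinuousLinearMap.flipₗᵢ ℝ Plane Plane ℝ).continuous.comp D.continuous⟩
  have hdθ : ∀ s, σ.eval (γ.loop s) (fieldCLM h s) (γ.vel s) =
      torusDeriv θ (γ.loop s) (fieldCLM h s) (γ.vel s)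
        - torusDeriv θ (γ.loop s) (γ.vel s) (fieldCLM h s) := by
    intro s
    obtain ⟨p, hp⟩ := proj_surjective (γ.loop s)
    rw [← hp, torusDeriv_proj]
    exact (hθ.d_eq p (hp ▸ hγ s) _ _).symm
  have hdiff : Integrable fun s => torusDeriv θ (γ.loop s) (fieldCLM h s) (γ.vel s) :=
    integrable_apply_continuous_sq D (fieldCLM h) γ.vel
  have hdiff' : Integrable fun s => torusDeriv θ (γ.loop s) (γ.vel s) (fieldCLM h s) :=
    integrable_apply_continuous_sq Dflip (fieldCLM h) γ.vel
  have hclosed := integral_torusDeriv_add hθ.isC1On hγ h.1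
  calc transgression σ γ h
      = ∫ s, (torusDeriv θ (γ.loop s) (fieldCLM h s) (γ.vel s)
          - torusDeriv θ (γ.loop s) (γ.vel s) (fieldCLM h s)) :=
        integral_congr_ae (Eventually.of_forall hdθ)
    _ = _ := by
        rw [integral_sub hdiff hdiff', sub_eq_add_neg]
        congr 1
        rw [neg_eq_iff_add_eq_zero,
          ← integral_add hdiff' (integrable_form hθ.isC1On hγ (velCLM h))]
        exact hclosed

lemma isPrimitiveOn_formIntegral {σ : TwoForm} {q₀ : Torus} {θ : Torus → Plane →L[ℝ] ℝ}
    (hθ : IsPrimitiveAway σ q₀ θ) :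
    IsPrimitiveOn (transgression σ) (formIntegral θ) (avoiding q₀) := by
  intro γ hγ
  obtain ⟨L, hL, hL_apply⟩ := hasFDerivAt_formIntegral_chart hθ.isC1On hγ
  exact ⟨L, hL, fun h => by rw [hL_apply, transgression_eq hθ hγ]⟩

lemma IsPrimitiveOn.kineticAction_add {σ : TwoForm} {f : Loops → ℝ} {W : Set Loops}
    (hf : IsPrimitiveOn (transgression σ) f W) (g : TorusMetric) (k : ℝ) :
    IsPrimitiveOn (actionForm g σ k) (fun γ => kineticAction g k γ + f γ) W := by
  intro γ hγ
  obtain ⟨L, hL, hL_apply⟩ := hf γ hγ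
  refine ⟨_, HasFDerivAt.add (𝕜 := ℝ) (E := Tangent)
    (differentiableAt_kineticAction_chart g k γ).hasFDerivAt hL, fun h => ?_⟩
  rw [actionForm, ← hL_apply]
  rfl

lemma IsPrimitiveOn.congr {η : OneForm} {f f' : Loops → ℝ} {W : Set Loops}
    (hf : IsPrimitiveOn η f W) (hW : IsOpen W) (hff' : EqOn f' f W) : IsPrimitiveOn η f' W := by
  intro γ hγ
  obtain ⟨L, hL, hL_apply⟩ := hf γ hγ
  refine ⟨L, HasFDerivAt.congr_of_eventuallyEq (E := Tangent) hL ?_, hL_apply⟩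
  have hmem : ∀ᶠ β in map (chart γ) (𝓝 0), β ∈ W := by
    rw [map_chart_nhds_zero]
    exact hW.mem_nhds hγ
  filter_upwards [hmem] with h hh using hff' hh

lemma isOpen_avoiding (q₀ : Torus) : IsOpen (avoiding q₀) := by
  have hloop : Continuous fun γ : Loops => γ.loop :=
    continuous_fst.comp (continuous_subtype_val.comp continuous_fst)
  have hopen := (ContinuousMap.isOpen_setOfPred_mapsTo (isCompact_univ (X := UnitAddCircle))
    (isOpen_ne (x := q₀))).preimage hloop
  convert! hopen using 1
  ext γ
  simp [avoiding, MapsTo]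

lemma freeAction_eq (g : TorusMetric) {θ : Torus → Plane →L[ℝ] ℝ} {O : Set Torus}
    (hθ : IsC1On θ O) (k : ℝ) {γ : Loops} (hγ : ∀ s, γ.loop s ∈ O) :
    freeAction g θ k γ = kineticAction g k γ + formIntegral θ γ := by
  obtain ⟨T, hT⟩ : ∃ T, γ.period = T := ⟨_, rfl⟩
  have hT₀ : T ≠ 0 := hT ▸ (period_pos γ).ne'
  have hkin := (integrable_metric g γ).const_mul (1 / 2 * T⁻¹ * T⁻¹)
  have hform := (integrable_form hθ hγ γ.vel).const_mul T⁻¹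
  have hsum : Integrable fun s => (1 / 2 * T⁻¹ * T⁻¹) * g.val (γ.loop s) (γ.vel s) (γ.vel s)
      + T⁻¹ * θ (γ.loop s) (γ.vel s) := hkin.add hform
  have hexpand : ∀ s, (1 / 2) * g.val (γ.loop s) (T⁻¹ • γ.vel s) (T⁻¹ • γ.vel s)
      + θ (γ.loop s) (T⁻¹ • γ.vel s) + k
      = (1 / 2 * T⁻¹ * T⁻¹) * g.val (γ.loop s) (γ.vel s) (γ.vel s)
        + T⁻¹ * θ (γ.loop s) (γ.vel s) + k := fun s => by
    simp only [map_smul, smul_apply, smul_eq_mul]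
    ring
  calc freeAction g θ k γ
      = T * ∫ s, ((1 / 2 * T⁻¹ * T⁻¹) * g.val (γ.loop s) (γ.vel s) (γ.vel s)
        + T⁻¹ * θ (γ.loop s) (γ.vel s) + k) := by simp only [freeAction, hT, hexpand]
    _ = T * ((1 / 2 * T⁻¹ * T⁻¹) * (∫ s, g.val (γ.loop s) (γ.vel s) (γ.vel s))
        + T⁻¹ * formIntegral θ γ + k) := by
      rw [integral_add hsum (integrable_const k), integral_add hkin hform,
        integral_const_mul, integral_const_mul, integral_const, probReal_univ, one_smul]
      rfl
    _ = kineticAction g k γ + formIntegral θ γ := by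
      rw [kineticAction, kinetic, hT]
      field_simp
      ring

theorem isPrimitiveOn_freeAction (g : TorusMetric) {σ : TwoForm} {q₀ : Torus}
    {θ : Torus → Plane →L[ℝ] ℝ} (hθ : IsPrimitiveAway σ q₀ θ) (k : ℝ) :
    IsPrimitiveOn (actionForm g σ k) (freeAction g θ k) (avoiding q₀) :=
  ((isPrimitiveOn_formIntegral hθ).kineticAction_add g k).congr (isOpen_avoiding q₀)
    fun _ hγ => freeAction_eq g hθ.isC1On k hγ

lemma kineticAction_change_energy (g : TorusMetric) (k k' : ℝ) (γ : Loops) :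
    kineticAction g k' γ = kineticAction g k γ - (k - k') * γ.period := by
  rw [kineticAction, kineticAction]
  ring

lemma actionForm_change_energy (g : TorusMetric) (σ : TwoForm) (k k' : ℝ) (γ : Loops)
    (h : Tangent) : actionForm g σ k' γ h = actionForm g σ k γ h - (k - k') * h.2 := by
  have hderiv := HasFDerivAt.fun_sub (E := Tangent)
    (differentiableAt_kineticAction_chart g k γ).hasFDerivAt
    (HasFDerivAt.const_mul (E := Tangent) (hasFDerivAt_period_chart γ) (k - k'))
  simp only [actionForm, kineticAction_change_energy g k k']
  rw [HasFDerivAt.fderiv (E := Tangent) hderiv]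
  simp only [sub_apply, smul_apply, ContinuousLinearMap.coe_snd', smul_eq_mul]
  ring

theorem IsPrimitiveOn.change_energy {g : TorusMetric} {σ : TwoForm} {k : ℝ} {f : Loops → ℝ}
    {W : Set Loops} (hf : IsPrimitiveOn (actionForm g σ k) f W) (k' : ℝ) :
    IsPrimitiveOn (actionForm g σ k') (fun γ => f γ - (k - k') * γ.period) W := by
  intro γ hγ
  obtain ⟨L, hL, hL_apply⟩ := hf γ hγ
  refine ⟨_, HasFDerivAt.sub (E := Tangent) hL
    (HasFDerivAt.const_mul (E := Tangent) (hasFDerivAt_period_chart γ) (k - k')), fun h => ?_⟩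
  rw [actionForm_change_energy g σ k k', ← hL_apply]
  rfl

end Action

lemma hasFDerivAt_add_half_quadratic {H V F : Type*} [NormedAddCommGroup H] [NormedSpace ℝ H]
    [NormedAddCommGroup V] [NormedSpace ℝ V] [NormedAddCommGroup F] [NormedSpace ℝ F]
    {Q : V →L[ℝ] F →L[ℝ] ℝ} {a : H →L[ℝ] V} {b : H →L[ℝ] F}
    (hsymm : ∀ h k, Q (a h) (b k) = Q (a k) (b h)) (v : F) (x : H) :
    HasFDerivAt (fun h => Q (a h) v + 1 / 2 * Q (a h) (b h)) ((Q.flip (v + b x)).comp a) x := by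
  have hQa : HasFDerivAt (fun h => Q (a h)) (Q.comp a) x := (Q.comp a).hasFDerivAt
  refine ((hQa.clm_apply (hasFDerivAt_const v x)).add
    ((hQa.clm_apply b.hasFDerivAt).const_mul (1 / 2))).congr_fderiv ?_
  ext k
  simp only [ContinuousLinearMap.comp_zero, zero_add, smul_add, add_apply,
    ContinuousLinearMap.flip_apply, ContinuousLinearMap.comp_apply, smul_apply, smul_eq_mul,
    map_add, hsymm x k]
  ring

lemma transgression_stdArea_chart (γ : Loops) (h k : Tangent) :
    transgression stdArea (chart γ h) k
      = pairing areaCLM (fieldCLM k) (γ.vel + velCLM h) := by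
  rw [pairing_apply]
  simp only [transgression, TwoForm.eval, stdArea, one_mul, areaCLM_apply, vel_chart]
  rfl

section AreaForm

set_option maxSynthPendingDepth 3

-- The area form has constant coefficients, so its transgression is affine in a chart, and it is
-- closed because `pairing areaCLM` is symmetric on `H¹` fields.
theorem exists_isPrimitiveOn_transgression_stdArea (γ : Loops) :
    ∃ (W : Set Loops) (f : Loops → ℝ), IsOpen W ∧ γ ∈ W ∧
      IsPrimitiveOn (transgression stdArea) f W := by
  have hderiv (h : Tangent) : HasFDerivAt
      (fun h => pairing areaCLM (fieldCLM h) γ.vel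
        + 1 / 2 * pairing areaCLM (fieldCLM h) (velCLM h))
      (((pairing areaCLM).flip (γ.vel + velCLM h)).comp fieldCLM) h :=
    hasFDerivAt_add_half_quadratic (H := Tangent)
      (fun h k => pairing_area_comm h.1 k.1) γ.vel h
  refine ⟨_, _, isOpen_image_chartBall γ, ⟨0, zero_mem_chartBall γ, chart_zero γ⟩,
    IsPrimitiveOn.of_hasFDerivAt fun h _ => ⟨_, hderiv h, fun k => ?_⟩⟩
  rw [transgression_stdArea_chart, ContinuousLinearMap.comp_apply, ContinuousLinearMap.flip_apply]

end AreaForm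

/-- `F` is an integral of the 1-form `η` along `u` on `S`: near every point of `S`, and within `S`,
its increments are those of a local primitive of `η` along `u`. Unlike `IsIntegralAlong`, this
makes sense on parts of the interval and does not normalize `F`. -/
def IsIntegralOn {X : Type*} [TopologicalSpace X] (η : OneForm) (u : X → Loops) (F : X → ℝ)
    (S : Set X) : Prop :=
  ∀ s₀ ∈ S, ∃ (W : Set Loops) (f : Loops → ℝ), IsOpen W ∧ u s₀ ∈ W ∧ IsPrimitiveOn η f W ∧
    ∀ᶠ s in 𝓝[S] s₀, F s - F s₀ = f (u s) - f (u s₀)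

lemma isIntegralAlong_iff {η : OneForm} {u : C(unitInterval, Loops)} {F : unitInterval → ℝ} :
    IsIntegralAlong η u F ↔ F 0 = 0 ∧ IsIntegralOn η u F univ := by
  simp only [IsIntegralAlong, IsIntegralOn, mem_univ, forall_true_left, nhdsWithin_univ]

section IntegralOn

variable {X Y : Type*} [TopologicalSpace X] [TopologicalSpace Y] {η : OneForm} {u : X → Loops}
  {F : X → ℝ} {S T : Set X}

lemma IsPrimitiveOn.isIntegralOn {f : Loops → ℝ} {W : Set Loops} (hf : IsPrimitiveOn η f W)
    (hW : IsOpen W) (hu : MapsTo u S W) : IsIntegralOn η u (f ∘ u) S :=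
  fun _ hs => ⟨W, f, hW, hu hs, hf, Eventually.of_forall fun _ => rfl⟩

lemma IsIntegralOn.comp (h : IsIntegralOn η u F T) {φ : Y → X} (hφ : Continuous φ) {S : Set Y}
    (hST : MapsTo φ S T) : IsIntegralOn η (u ∘ φ) (F ∘ φ) S := by
  intro s₀ hs₀
  obtain ⟨W, f, hW, hmem, hf, hev⟩ := h (φ s₀) (hST hs₀)
  exact ⟨W, f, hW, hmem, hf, (hφ.continuousWithinAt.tendsto_nhdsWithin hST).eventually hev⟩

lemma IsIntegralOn.congr (h : IsIntegralOn η u F S) {u' : X → Loops} {F' : X → ℝ} {c : ℝ}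
    (hu : EqOn u' u S) (hF : ∀ s ∈ S, F' s = F s + c) : IsIntegralOn η u' F' S := by
  intro s₀ hs₀
  obtain ⟨W, f, hW, hmem, hf, hev⟩ := h s₀ hs₀
  refine ⟨W, f, hW, hu hs₀ ▸ hmem, hf, ?_⟩
  filter_upwards [hev, self_mem_nhdsWithin] with s hs hsS
  rw [hF s hsS, hF s₀ hs₀, hu hsS, hu hs₀, add_sub_add_right_eq_sub, hs]

lemma IsIntegralOn.union (hS : IsClosed S) (hT : IsClosed T) (hu : Continuous u)
    (h₁ : IsIntegralOn η u F S) (h₂ : IsIntegralOn η u F T) : IsIntegralOn η u F (S ∪ T) := by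
  have eq_bot {A : Set X} (hA : IsClosed A) {s : X} (hs : s ∉ A) : 𝓝[A] s = ⊥ :=
    notMem_closure_iff_nhdsWithin_eq_bot.1 (hA.closure_eq.symm ▸ hs)
  intro s₀ hs₀
  rw [nhdsWithin_union]
  by_cases hs₁ : s₀ ∈ S
  · obtain ⟨W₁, f₁, hW₁, hmem₁, hf₁, hev₁⟩ := h₁ s₀ hs₁
    refine ⟨W₁, f₁, hW₁, hmem₁, hf₁, eventually_sup.2 ⟨hev₁, ?_⟩⟩
    by_cases hs₂ : s₀ ∈ T
    · obtain ⟨W₂, f₂, hW₂, hmem₂, hf₂, hev₂⟩ := h₂ s₀ hs₂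
      have hsub := hf₁.eventually_sub_eq hf₂ (hW₁.mem_nhds hmem₁) (hW₂.mem_nhds hmem₂)
      filter_upwards [hev₂, nhdsWithin_le_nhds (hu.tendsto s₀ |>.eventually hsub)] with s hF hf
      exact hF.trans hf.symm
    · simp only [eq_bot hT hs₂, eventually_bot]
  · obtain ⟨W₂, f₂, hW₂, hmem₂, hf₂, hev₂⟩ := h₂ s₀ (hs₀.resolve_left hs₁)
    exact ⟨W₂, f₂, hW₂, hmem₂, hf₂, eventually_sup.2 ⟨by simp only [eq_bot hS hs₁, eventually_bot],
      hev₂⟩⟩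

end IntegralOn

lemma IsIntegralOn.extend_Iic {η : OneForm} {u : C(unitInterval, Loops)} {F : unitInterval → ℝ}
    {a b : unitInterval} (hF : IsIntegralOn η u F (Iic a)) (hab : a ≤ b) {f : Loops → ℝ}
    {W : Set Loops} (hf : IsPrimitiveOn η f W) (hW : IsOpen W) (hu : MapsTo u (Icc a b) W) :
    ∃ F' : unitInterval → ℝ, F' 0 = F 0 ∧ IsIntegralOn η u F' (Iic b) := by
  rw [← Iic_union_Icc_eq_Iic hab]
  refine ⟨fun s => F (min s a) + (f (u (max s a)) - f (u a)), ?_,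
    .union isClosed_Iic isClosed_Icc u.continuous (hF.congr (eqOn_refl u _) (c := 0) ?_)
      ((hf.isIntegralOn hW hu).congr (eqOn_refl u _) (c := F a - f (u a)) ?_)⟩
  · simp only [min_eq_left unitInterval.nonneg', max_eq_right unitInterval.nonneg', sub_self,
      add_zero]
  · intro s hs
    rw [min_eq_left hs, max_eq_right hs, sub_self]
  · intro s hs
    rw [min_eq_right hs.1, max_eq_left hs.1, Function.comp_apply]
    ring

theorem exists_isIntegralAlong {η : OneForm} (hη : ∀ γ : Loops, ∃ (W : Set Loops) (f : Loops → ℝ),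
      IsOpen W ∧ γ ∈ W ∧ IsPrimitiveOn η f W) (u : C(unitInterval, Loops)) :
    ∃ F, IsIntegralAlong η u F := by
  choose W f hW hmem hf using hη
  obtain ⟨t, ht0, htm, ⟨N, hN⟩, ht⟩ := exists_monotone_Icc_subset_open_cover_unitInterval
    (c := fun γ => u ⁻¹' W γ) (fun γ => (hW γ).preimage u.continuous)
    (fun s _ => mem_iUnion.2 ⟨u s, hmem _⟩)
  suffices H : ∀ n, ∃ F : unitInterval → ℝ, F 0 = 0 ∧ IsIntegralOn η u F (Iic (t n)) by
    obtain ⟨F, hF0, hF⟩ := H N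
    refine ⟨F, isIntegralAlong_iff.2 ⟨hF0, ?_⟩⟩
    rwa [hN N le_rfl, show Iic (1 : unitInterval) = univ from Iic_top] at hF
  intro n
  induction n with
  | zero =>
    refine ⟨fun s => f (u 0) (u s) - f (u 0) (u 0), sub_self _,
      ((hf (u 0)).isIntegralOn (hW _) fun s hs => ?_).congr (eqOn_refl u _)
        fun _ _ => sub_eq_add_neg _ _⟩
    obtain rfl : s = 0 := le_antisymm (ht0 ▸ hs) unitInterval.nonneg'
    exact hmem _
  | succ n ih =>
    obtain ⟨F, hF0, hF⟩ := ih
    obtain ⟨γ, hγ⟩ := ht n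
    obtain ⟨F', hF'0, hF'⟩ := hF.extend_Iic (htm n.le_succ) (hf γ) (hW γ) hγ
    exact ⟨F', hF'0.trans hF0, hF'⟩

lemma isIntegralAlong_of_isPrimitiveOn {η : OneForm} {f : Loops → ℝ} {W : Set Loops}
    (hf : IsPrimitiveOn η f W) (hW : IsOpen W) {u : C(unitInterval, Loops)} (hu : ∀ s, u s ∈ W) :
    IsIntegralAlong η u fun s => f (u s) - f (u 0) :=
  isIntegralAlong_iff.2 ⟨sub_self _, (hf.isIntegralOn hW fun s _ => hu s).congr (eqOn_refl u _)
    fun _ _ => sub_eq_add_neg _ _⟩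

lemma IsIntegralAlong.change_energy {g : TorusMetric} {σ : TwoForm} {k : ℝ}
    {u : C(unitInterval, Loops)} {F : unitInterval → ℝ}
    (hF : IsIntegralAlong (actionForm g σ k) u F) (k' : ℝ) :
    IsIntegralAlong (actionForm g σ k') u
      fun s => F s - (k - k') * ((u s).period - (u 0).period) := by
  refine ⟨by simp only [hF.1, sub_self, mul_zero], fun s₀ => ?_⟩
  obtain ⟨W, f, hW, hmem, hf, hev⟩ := hF.2 s₀
  refine ⟨W, _, hW, hmem, hf.change_energy k', ?_⟩
  filter_upwards [hev] with s hs
  linear_combination hs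

section Concatenation

variable {η : OneForm} {a b c : Loops} {F₁ F₂ : unitInterval → ℝ}

/-- The reparametrization `s ↦ 2 s` of the first half of a concatenation, stopped at `1`. -/
def firstHalf : C(unitInterval, unitInterval) :=
  ⟨fun s => projIcc 0 1 zero_le_one (2 * s), continuous_projIcc.comp (by fun_prop)⟩

/-- The reparametrization `s ↦ 2 s - 1` of the second half of a concatenation, started at `0`. -/
def secondHalf : C(unitInterval, unitInterval) :=
  ⟨fun s => projIcc 0 1 zero_le_one (2 * s - 1), continuous_projIcc.comp (by fun_prop)⟩

lemma firstHalf_of_half_le {s : unitInterval} (hs : (1 / 2 : ℝ) ≤ s) : firstHalf s = 1 :=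
  projIcc_of_right_le zero_le_one (by linarith)

lemma secondHalf_of_le_half {s : unitInterval} (hs : (s : ℝ) ≤ 1 / 2) : secondHalf s = 0 :=
  projIcc_of_le_left zero_le_one (by linarith)

lemma trans_of_le_half (p : Path a b) (q : Path b c) {s : unitInterval} (hs : (s : ℝ) ≤ 1 / 2) :
    (p.trans q) s = p (firstHalf s) :=
  if_pos hs

lemma trans_of_half_le (p : Path a b) (q : Path b c) {s : unitInterval}
    (hs : (1 / 2 : ℝ) ≤ s) : (p.trans q) s = q (secondHalf s) := by
  rcases hs.eq_or_lt with hs | hs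
  · rw [trans_of_le_half p q hs.ge, firstHalf_of_half_le hs.le, secondHalf_of_le_half hs.ge,
      p.target, q.source]
  · exact if_neg hs.not_ge

/-- The integral along a concatenation of paths, in terms of the integrals along its two parts. -/
def concatIntegral (F₁ F₂ : unitInterval → ℝ) (s : unitInterval) : ℝ :=
  F₁ (firstHalf s) + F₂ (secondHalf s)

lemma concatIntegral_of_le_half (h₂ : F₂ 0 = 0) {s : unitInterval} (hs : (s : ℝ) ≤ 1 / 2) :
    concatIntegral F₁ F₂ s = F₁ (firstHalf s) := by
  rw [concatIntegral, secondHalf_of_le_half hs, h₂, add_zero]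

lemma concatIntegral_of_half_le {s : unitInterval} (hs : (1 / 2 : ℝ) ≤ s) :
    concatIntegral F₁ F₂ s = F₁ 1 + F₂ (secondHalf s) := by
  rw [concatIntegral, firstHalf_of_half_le hs]

lemma concatIntegral_one : concatIntegral F₁ F₂ 1 = F₁ 1 + F₂ 1 := by
  rw [concatIntegral_of_half_le (by norm_num),
    show secondHalf 1 = 1 from projIcc_of_right_le zero_le_one (by norm_num)]

lemma concatIntegral_eq_or (h₂ : F₂ 0 = 0) (s : unitInterval) :
    (∃ t, concatIntegral F₁ F₂ s = F₁ t) ∨ ∃ t, concatIntegral F₁ F₂ s = F₁ 1 + F₂ t :=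
  (le_total (s : ℝ) (1 / 2)).imp (fun hs => ⟨_, concatIntegral_of_le_half h₂ hs⟩)
    fun hs => ⟨_, concatIntegral_of_half_le hs⟩

lemma IsIntegralAlong.trans {p : Path a b} {q : Path b c}
    (h₁ : IsIntegralAlong η p.toContinuousMap F₁) (h₂ : IsIntegralAlong η q.toContinuousMap F₂) :
    IsIntegralAlong η (p.trans q).toContinuousMap (concatIntegral F₁ F₂) := by
  refine isIntegralAlong_iff.2 ⟨?_, ?_⟩
  · rw [concatIntegral_of_le_half h₂.1 (by norm_num),
      show firstHalf 0 = 0 from projIcc_of_le_left zero_le_one (by norm_num), h₁.1]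
  have hcover : {s : unitInterval | (s : ℝ) ≤ 1 / 2} ∪ {s | (1 / 2 : ℝ) ≤ s} = univ :=
    eq_univ_of_forall fun s => le_total (s : ℝ) (1 / 2)
  rw [← hcover]
  refine .union (isClosed_le (by fun_prop) (by fun_prop))
    (isClosed_le (by fun_prop) (by fun_prop)) (p.trans q).continuous ?_ ?_
  · exact ((isIntegralAlong_iff.1 h₁).2.comp firstHalf.continuous (mapsTo_univ _ _)).congr
      (fun s hs => trans_of_le_half p q hs)
      fun s hs => (concatIntegral_of_le_half h₂.1 hs).trans (add_zero _).symm
  · exact ((isIntegralAlong_iff.1 h₂).2.comp secondHalf.continuous (mapsTo_univ _ _)).congr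
      (fun s hs => trans_of_half_le p q hs)
      fun s hs => (concatIntegral_of_half_le hs).trans (add_comm _ _)

lemma IsIntegralAlong.symm {p : Path a b} {F : unitInterval → ℝ}
    (h : IsIntegralAlong η p.toContinuousMap F) :
    IsIntegralAlong η p.symm.toContinuousMap fun s => F (unitInterval.symm s) - F 1 :=
  isIntegralAlong_iff.2 ⟨by rw [unitInterval.symm_zero, sub_self],
    ((isIntegralAlong_iff.1 h).2.comp unitInterval.continuous_symm (mapsTo_univ _ _)).congr
      (eqOn_refl _ _) fun _ _ => sub_eq_add_neg _ _⟩

theorem IsIntegralAlong.exists_conj {p : Path a b} {q : Path b b} {P Q : unitInterval → ℝ}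
    (hP : IsIntegralAlong η p.toContinuousMap P) (hQ : IsIntegralAlong η q.toContinuousMap Q) :
    ∃ F, IsIntegralAlong η ((p.trans q).trans p.symm).toContinuousMap F ∧ F 1 = Q 1 ∧
      ∀ s, ∃ t, F s = P t ∨ F s = P 1 + Q t ∨ F s = Q 1 + P t := by
  refine ⟨_, (hP.trans hQ).trans hP.symm, ?_, fun s => ?_⟩
  · rw [concatIntegral_one, concatIntegral_one, unitInterval.symm_one, hP.1]
    ring
  · obtain ⟨t, ht⟩ | ⟨t, ht⟩ := concatIntegral_eq_or (F₁ := concatIntegral P Q)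
      (F₂ := fun s => P (unitInterval.symm s) - P 1) hP.symm.1 s
    · obtain ⟨r, hr⟩ | ⟨r, hr⟩ := concatIntegral_eq_or (F₁ := P) hQ.1 t
      · exact ⟨r, .inl (ht.trans hr)⟩
      · exact ⟨r, .inr (.inl (ht.trans hr))⟩
    · refine ⟨unitInterval.symm t, .inr (.inr (ht.trans ?_))⟩
      rw [concatIntegral_one]
      ring

end Concatenation

section Iterates

variable {θ : Torus → Plane →L[ℝ] ℝ} {O : Set Torus} {γ : Loops}

lemma continuous_iterate (n : ℕ+) : Continuous (iterate n) := by
  have hloop : Continuous fun γ : Loops => γ.loop :=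
    continuous_fst.comp (continuous_subtype_val.comp continuous_fst)
  have hvel : Continuous fun γ : Loops => γ.vel :=
    continuous_snd.comp (continuous_subtype_val.comp continuous_fst)
  refine .prodMk (.subtype_mk (.prodMk ?_ ?_) _) (.subtype_mk (by fun_prop) _)
  · exact (ContinuousMap.continuous_precomp
      (⟨fun s => (n : ℕ) • s, by fun_prop⟩ : C(UnitAddCircle, UnitAddCircle))).comp hloop
  · exact Continuous.const_smul (M := ℝ) ((Lp.isometry_compMeasurePreserving
      (measurePreserving_nsmul n)).continuous.comp hvel) ((n : ℕ) : ℝ)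

lemma vel_iterate (n : ℕ+) (γ : Loops) :
    (iterate n γ).vel =ᵐ[volume] fun s => (n : ℝ) • γ.vel ((n : ℕ) • s) := by
  filter_upwards [Lp.coeFn_smul (n : ℝ) (Lp.compMeasurePreserving _ (measurePreserving_nsmul n)
    γ.vel), Lp.coeFn_compMeasurePreserving γ.vel (measurePreserving_nsmul n)] with s hsmul hcomp
  exact hsmul.trans (congrArg ((n : ℝ) • ·) hcomp)

lemma integral_iterate (n : ℕ+) {Ψ : Torus → Plane → ℝ}
    (hΨ : AEStronglyMeasurable fun s => Ψ (γ.loop s) ((n : ℝ) • γ.vel s)) :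
    ∫ s, Ψ ((iterate n γ).loop s) ((iterate n γ).vel s)
      = ∫ s, Ψ (γ.loop s) ((n : ℝ) • γ.vel s) := by
  have hmp := measurePreserving_nsmul n
  have hchange := integral_map (f := fun s => Ψ (γ.loop s) ((n : ℝ) • γ.vel s)) hmp.aemeasurable
    (by rwa [hmp.map_eq])
  rw [hmp.map_eq] at hchange
  rw [hchange]
  refine integral_congr_ae ?_
  filter_upwards [vel_iterate n γ] with s hs
  rw [hs]
  rfl

lemma kinetic_iterate (g : TorusMetric) (n : ℕ+) (γ : Loops) :
    kinetic g (iterate n γ) = n ^ 2 * kinetic g γ := by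
  have hscale (s : UnitAddCircle) : g.val (γ.loop s) ((n : ℝ) • γ.vel s) ((n : ℝ) • γ.vel s)
      = n ^ 2 * g.val (γ.loop s) (γ.vel s) (γ.vel s) := by
    simp only [map_smul, smul_apply, smul_eq_mul]
    ring
  rw [kinetic, integral_iterate n (Ψ := fun q v => g.val q v v)
    (by simpa only [hscale] using ((integrable_metric g γ).const_mul _).aestronglyMeasurable)]
  simp only [hscale, integral_const_mul, kinetic]
  ring

lemma formIntegral_iterate (hθ : IsC1On θ O) (hγ : ∀ s, γ.loop s ∈ O) (n : ℕ+) :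
    formIntegral θ (iterate n γ) = n * formIntegral θ γ := by
  have hscale (s : UnitAddCircle) : θ (γ.loop s) ((n : ℝ) • γ.vel s)
      = n * θ (γ.loop s) (γ.vel s) := by rw [map_smul, smul_eq_mul]
  rw [formIntegral, integral_iterate n (Ψ := fun q v => θ q v)
    (by simpa only [hscale] using ((integrable_form hθ hγ γ.vel).const_mul _).aestronglyMeasurable)]
  simp only [hscale, integral_const_mul, formIntegral]

theorem freeAction_iterate (g : TorusMetric) (hθ : IsC1On θ O) (k : ℝ) (hγ : ∀ s, γ.loop s ∈ O)
    (n : ℕ+) : freeAction g θ k (iterate n γ) = n * freeAction g θ k γ := by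
  rw [freeAction_eq g hθ k hγ, freeAction_eq g hθ k (γ := iterate n γ) fun _ => hγ _,
    formIntegral_iterate hθ hγ,
    kineticAction, kineticAction, kinetic_iterate,
    show (iterate n γ).period = n * γ.period from rfl]
  have hT := (period_pos γ).ne'
  field_simp

end Iterates

section Minimax

variable {g : TorusMetric} {σ : TwoForm} {q₀ : Torus} {θ : Torus → Plane →L[ℝ] ℝ}

lemma conj_mem_minimaxClass {α : Loops} {U : Set Loops} {n : ℕ+} {k k' : ℝ} {a b : Loops}
    (p : Path a b) {q : Path b b} (hq : q.toContinuousMap ∈ minimaxClass g θ α U n k)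
    (ha : a ∈ iterate n '' minimizers g θ U k') :
    ((p.trans q).trans p.symm).toContinuousMap ∈ minimaxClass g θ α U n k' := by
  obtain ⟨hcomponent, -, -, G, hG, hG₁⟩ := hq
  obtain ⟨P, hP⟩ := exists_isIntegralAlong exists_isPrimitiveOn_transgression_stdArea
    p.toContinuousMap
  obtain ⟨G', hG', hG'₁, -⟩ := hP.exists_conj hG
  refine ⟨fun s => ?_, ((p.trans q).trans p.symm).source.trans
    ((p.trans q).trans p.symm).target.symm, ?_, G', hG', hG'₁ ▸ hG₁⟩
  · have hb : b ∈ connectedComponent (iterate n α) := q.source ▸ hcomponent 0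
    have hb_range : b ∈ range ((p.trans q).trans p.symm) := by
      rw [Path.trans_range, Path.trans_range]
      exact .inl (.inl ⟨1, p.target⟩)
    rw [connectedComponent_eq hb]
    exact (isPreconnected_range ((p.trans q).trans p.symm).continuous).subset_connectedComponent
      hb_range ⟨s, rfl⟩
  · change ((p.trans q).trans p.symm) 0 ∈ _
    rwa [Path.source]

lemma exists_actionAlong_conj_le (hθ : IsPrimitiveAway σ q₀ θ) {k : ℝ} {a b : Loops}
    {p : Path a b} {q : Path b b} {Q : unitInterval → ℝ}
    (hQ : IsIntegralAlong (actionForm g σ k) q.toContinuousMap Q) (hp : ∀ s, p s ∈ avoiding q₀)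
    (hle : ∀ s, freeAction g θ k (p s) ≤ freeAction g θ k b) :
    ∃ F, IsIntegralAlong (actionForm g σ k) ((p.trans q).trans p.symm).toContinuousMap F ∧
      ∀ s, ∃ t, actionAlong g θ k ((p.trans q).trans p.symm).toContinuousMap F s
        ≤ actionAlong g θ k q.toContinuousMap Q t := by
  have hP := isIntegralAlong_of_isPrimitiveOn (isPrimitiveOn_freeAction g hθ k)
    (isOpen_avoiding q₀) (u := p.toContinuousMap) hp
  obtain ⟨F, hF, -, hF_eq⟩ := hP.exists_conj hQ
  refine ⟨F, hF, fun s => ?_⟩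
  simp only [actionAlong, Path.coe_toContinuousMap, Path.source, Path.target] at hF_eq ⊢
  obtain ⟨t, ht | ht | ht⟩ := hF_eq s
  · exact ⟨0, by rw [ht, hQ.1]; linarith [hle t]⟩
  · exact ⟨t, by rw [ht]; linarith⟩
  · exact ⟨1, by rw [ht]; linarith [hle t]⟩

lemma actionAlong_change_energy {O : Set Torus} (hθ : IsC1On θ O) (k k' : ℝ)
    {u : C(unitInterval, Loops)} (hu : ∀ s, (u 0).loop s ∈ O) (F : unitInterval → ℝ)
    (s : unitInterval) :
    actionAlong g θ k' u (fun s => F s - (k - k') * ((u s).period - (u 0).period)) s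
      = actionAlong g θ k u F s - (k - k') * (u s).period := by
  rw [actionAlong, actionAlong, freeAction_eq g hθ k hu, freeAction_eq g hθ k' hu,
    kineticAction_change_energy g k k']
  ring

end Minimax

end MagneticTorus

end

open MagneticTorus in
theorem lemma5p5_general (g : TorusMetric) (σ : TwoForm) (α : Loops) (q₀ : Torus)
    (θ : Torus → Plane →L[ℝ] ℝ) (hθ : IsPrimitiveAway σ q₀ θ) (U : Set Loops) (n : ℕ+)
    {km kp : ℝ} (hle : km ≤ kp)
    (hconnect : ∀ β ∈ minimizers g θ U kp, ∃ w : C(unitInterval, Loops),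
      (∀ s, w s ∈ avoiding q₀) ∧ w 0 ∈ minimizers g θ U km ∧ w 1 = β ∧
        ∀ s, freeAction g θ km (w s) ≤ freeAction g θ km β) :
    minimaxValue g σ θ α U n km ≤ minimaxValue g σ θ α U n kp := by
  refine le_iInf₂ fun u hu => le_iInf₂ fun F hF => ?_
  obtain ⟨β, hβ, hβu⟩ := hu.2.2.1
  obtain ⟨w, hw, hw₀, rfl, hw_le⟩ := hconnect β hβ
  let p : Path (iterate n (w 0)) (u 0) :=
    ⟨⟨fun s => iterate n (w s), (continuous_iterate n).comp w.continuous⟩, rfl, hβu⟩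
  let q : Path (u 0) (u 0) := ⟨u, rfl, hu.2.1.symm⟩
  have hp (s) : p s ∈ avoiding q₀ := fun _ => hw s _
  have hp_le (s) : freeAction g θ km (p s) ≤ freeAction g θ km (u 0) := calc
    freeAction g θ km (p s) = n * freeAction g θ km (w s) :=
      freeAction_iterate g hθ.isC1On km (hw s) n
    _ ≤ n * freeAction g θ km (w 1) := mul_le_mul_of_nonneg_left (hw_le s) (Nat.cast_nonneg _)
    _ = freeAction g θ km (u 0) := by rw [← freeAction_iterate g hθ.isC1On km (hw 1), hβu]
  have hconj := conj_mem_minimaxClass p (q := q) hu ⟨w 0, hw₀, rfl⟩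
  obtain ⟨F', hF', hF'_le⟩ := exists_actionAlong_conj_le hθ (q := q) (hF.change_energy km) hp hp_le
  refine (iInf₂_le_of_le _ hconj (iInf₂_le F' hF')).trans (iSup_mono' fun s => ?_)
  obtain ⟨t, ht⟩ := hF'_le s
  refine ⟨t, EReal.coe_le_coe_iff.2 (ht.trans ?_)⟩
  rw [actionAlong_change_energy hθ.isC1On kp km (u := q.toContinuousMap) (p.target ▸ hp 1) F t]
  exact sub_le_self _ (mul_nonneg (sub_nonneg.2 hle) (period_pos _).le)

theorem lemma5p5 (g : MagneticTorus.TorusMetric) (σ : MagneticTorus.TwoForm) (hσ : σ.Oscillating)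
    (kstar : ℝ) (hk : 0 < kstar)
    (α : MagneticTorus.Loops) (hα : ¬ MagneticTorus.Contractible α)
    (q₀ : MagneticTorus.Torus) (hq₀ : α ∈ MagneticTorus.avoiding q₀)
    (θ : MagneticTorus.Torus → MagneticTorus.Plane →L[ℝ] ℝ)
    (hθ : MagneticTorus.IsPrimitiveAway σ q₀ θ)
    (hmin : MagneticTorus.IsStrictLocalMinimizer g q₀ θ kstar α)
    (U : Set MagneticTorus.Loops)
    (hU : MagneticTorus.IsMinimizerNeighborhood g q₀ θ kstar α U)
    (I : Set ℝ) (hI : MagneticTorus.IsMinimaxInterval g θ U kstar I)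
    (n : ℕ+) (km kp : ℝ) (hkm : km ∈ I) (hkp : kp ∈ I) (hlt : km < kp) :
    MagneticTorus.minimaxValue g σ θ α U n km ≤ MagneticTorus.minimaxValue g σ θ α U n kp := by
  refine lemma5p5_general g σ α q₀ θ hθ U n hlt.le fun β hβ => ?_
  obtain ⟨w, hwU, hw⟩ := hI.connect km hkm kp hkp hlt β hβ
  exact ⟨w, fun s => hU.closure_subset (subset_closure (hwU s)), hw⟩
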